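/- Let $\mathbb H^2=\{z=(z_1,z_2)\in\mathbb R^2: z_2>0\}$ carry the hyperbolic metric $z_2^{-2}(dz_1^2+dz_2^2)$. A loop is a curve $u:\mathbb S^1\to\mathbb H^2$ of class $C^2$ with nowhere vanishing derivative; it is embedded if it is injective. Given $F:\mathbb H^2\to\mathbb R$, an $F$-loop is a loop $u$ whose geodesic curvature $\langle\nabla_{u'}u',iu'\rangle/|u'|^3$ (with respect to the hyperbolic metric, its Levi-Civita connection $\nabla$, and the counterclockwise rotation $i$ by $\pi/2$) equals $F(u)$ at each point. Let $A$ be an open set whose closure $\overline A$ is a compact subset of $\mathbb H^2$. A function $X\in C^1(\mathbb H^2)$ has a stable critical point in $A$ if there is $r>0$ such that every function $G$ of class $C^1$ on a neighbourhood of $\overline A$ with $\|G-X\|_{C^1(\overline A)}<r$ has a critical point in $A$. **Theorem.** Let $K\in C^1(\mathbb H^2)$ have a stable critical point in an open set $A$ whose closure is a compact subset of $\mathbb H^2$. Then there is $k_0>1$ such that for every $k>k_0$ there is $\varepsilon_0>0$ such that for every $\varepsilon\in\mathbb R$ with $|\varepsilon|<\varepsilon_0$ there exists an embedded $(k+\varepsilon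 K)$-loop. Moreover, let $k_h\to\infty$ and $\varepsilon_h\to0$ be any real sequences. Then there exist indices $h_1<h_2<\cdots$, a point $z_\infty\in\overline A$ that is critical for $K$, and, for each $j$, an embedded $(k_{h_j}+\varepsilon_{h_j}K)$-loop $u^j$ such that $u^j$ converges in $C^2(\mathbb S^1,\mathbb R^2)$ to the constant curve $z_\infty$ as $j\to\infty$. -/

import Mathlib

open Filter Topology

/-- The hyperbolic plane, as the open upper half of `ℂ ≃ ℝ²`. -/
abbrev HypPlane : Set ℂ := UpperHalfPlane.upperHalfPlaneSet

/-- The half-plane metric `g_z(v, w) = z₂⁻² (v · w)`. -/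
noncomputable def hypInner (z v w : ℂ) : ℝ := inner ℝ v w / z.im ^ 2

/-- The hyperbolic length `|v|_g` of a tangent vector `v` at `z`. -/
noncomputable def hypNorm (z v : ℂ) : ℝ := Real.sqrt (hypInner z v v)

/-- The covariant acceleration `∇_{c'} c' = c'' - c₂⁻¹ Γ(c')` for the Levi-Civita connection of the
half-plane metric, where `Γ(v) = (2 v₁ v₂, v₂² - v₁²) = -i v²`. -/
noncomputable def hypAccel (c : ℝ → ℂ) (t : ℝ) : ℂ :=
  deriv (deriv c) t - (((c t).im)⁻¹ : ℝ) * (-Complex.I * deriv c t ^ 2)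

/-- The geodesic curvature `⟨∇_{c'} c', i c'⟩_g / |c'|_g³` of a regular curve of class `C²`. -/
noncomputable def geodesicCurvature (c : ℝ → ℂ) (t : ℝ) : ℝ :=
  hypInner (c t) (hypAccel c t) (Complex.I * deriv c t) / hypNorm (c t) (deriv c t) ^ 3

/-- A map on the unit circle, read in the angle `θ`. Its derivative in `θ` at `x = exp (iθ)` is the
derivative `u'(x)(ix)` of `u` along the unit tangent vector `ix`. -/
noncomputable def angular (u : Circle → ℂ) (θ : ℝ) : ℂ := u (Circle.exp θ)

/-- Loops in the hyperbolic plane: curves `𝕊¹ → ℍ²` of class `C²` with nowhere zero derivative. -/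
structure IsLoop (u : Circle → ℂ) : Prop where
  mem : ∀ x, u x ∈ HypPlane
  contDiff : ContDiff ℝ 2 (angular u)
  regular : ∀ θ, deriv (angular u) θ ≠ 0

/-- `K`-loops: loops whose geodesic curvature at each point is the value of `K` there. -/
structure IsKLoop (K : ℂ → ℝ) (u : Circle → ℂ) : Prop extends IsLoop u where
  curvature : ∀ θ, geodesicCurvature (angular u) θ = K (angular u θ)

/-- Embedded `K`-loops. -/
structure IsEmbeddedKLoop (K : ℂ → ℝ) (u : Circle → ℂ) : Prop extends IsKLoop K u where
  injective : Function.Injective u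

/-- Convergence in `C²(𝕊¹, ℝ²)`: uniform convergence of the derivatives of order `0`, `1`, `2`. -/
def TendstoC2 (u : ℕ → Circle → ℂ) (v : Circle → ℂ) : Prop :=
  ∀ m ≤ 2, TendstoUniformly (fun j => iteratedDeriv m (angular (u j)))
    (iteratedDeriv m (angular v)) atTop

/-- `X` has a stable critical point in the open set `A` with compact closure: there is `r > 0` such
that every `G ∈ C¹(Ā)` with `‖G - X‖_{C¹(Ā)} < r` has a critical point in `A`. The functions in
`C¹(Ā)` are those of class `C¹` on an open neighbourhood of `Ā`. (Testing with a larger class of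
functions `G`, as the `C¹` functions on `A` that extend continuously to `Ā` together with their
gradients, would be a more restrictive condition on `X`.) -/
def HasStableCriticalPoint (X : ℂ → ℝ) (A : Set ℂ) : Prop :=
  ∃ r > 0, ∀ G : ℂ → ℝ,
    (∃ U : Set ℂ, IsOpen U ∧ closure A ⊆ U ∧ ContDiffOn ℝ 1 G U) →
    (∀ z ∈ closure A, |G z - X z| + ‖fderiv ℝ G z - fderiv ℝ X z‖ < r) →
    ∃ z ∈ A, fderiv ℝ G z = 0

/-! The proof is a Lyapunov–Schmidt reduction around small circles. Parametrize a closed curve `(u,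
v)` by the angle `θ` of its normal, so that its derivative is `r (-sin θ, cos θ)`. Its geodesic
curvature is then `v / r - sin θ` (`geodesicCurvature_eq`), and the equation to solve is `v = r (k +
ε K + sin θ)`. Put `s = 1 / k`. For small `s` and each centre `z`, a contraction argument
(`exists_profile`, `exists_curve_family`) yields a curve of mean exactly `z`, close to the circle of
radius `s z₂`, that solves the equation up to a term `(a cos θ + b sin θ) v²`. It remains to find
`z` with `a = b = 0`.

The multiplier is a gradient. Let `E(z)` be the hyperbolic length of the curve at `z` minus the
enclosed area weighted by `k + ε K`. The difference of two curves with the same normals is again a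
curve of this kind, possibly with signed speed. Integrating a first harmonic against the support
function of such a curve only sees its mean (`integral_harmonic_mul_support`). Hence the first
variation of `E` at the curve of centre `z`, applied to the difference with the curve of centre `w`,
equals `π (a, b) · (w - z)` exactly. Lipschitz dependence on `z` is thus enough to get `∇E = π (a,
b)` (`hasFDerivAt_curveEnergy`), and no derivative of the family in `z` is needed.

The multiplier is also explicit to leading order. Horizontal translations and dilations are
isometries, so pairing the equation with these two Killing fields removes everything that does not
carry `ε`. They also preserve area, so `K` may be replaced by `K - K(z)`, and the Taylor expansion
of `K` gives `(a, b) = -ε s² (∇K(z) + o(1))` as `s → 0`, uniformly in `|ε| ≤ 1`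
(`exists_multiplier_bound`).

For `ε ≠ 0`, the function `-E / (π ε s²)` plus a constant is therefore `C¹`-close to `K` near the
closure of `A`, and stability produces a critical point in `A`, where the multiplier vanishes. For
`ε = 0` the multiplier is zero at every centre. The resulting curve has `r > 0`, hence is embedded,
and its first two derivatives are `O(s)`. Since the threshold on `s` is uniform in `ε` and the
centre is almost critical for `K`, compactness of the closure of `A` gives the limit statement. -/

/-! ### Linear operators on continuous functions on the circle: means, primitives, first harmonics.
-/

section CircleOperators

open Real MeasureTheory intervalIntegral

/-- A continuous `2π`-periodic function, as a continuous map on the circle. -/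
noncomputable def circleLift (h : ℝ → ℝ) (hc : Continuous h)
    (hp : Function.Periodic h (2 * π)) : C(Circle, ℝ) where
  toFun x := hp.lift (AddCircle.homeomorphCircle'.symm x)
  continuous_toFun := by
    refine Continuous.comp ?_ AddCircle.homeomorphCircle'.symm.continuous
    exact continuous_coinduced_dom.mpr hc

lemma circleLift_exp (h : ℝ → ℝ) (hc : Continuous h) (hp : Function.Periodic h (2 * π)) (θ : ℝ) :
    circleLift h hc hp (Circle.exp θ) = h θ := by
  change hp.lift (AddCircle.homeomorphCircle'.symm (Circle.exp θ)) = h θ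
  rw [← AddCircle.homeomorphCircle'_apply_mk, Homeomorph.symm_apply_apply]
  exact hp.lift_coe θ

lemma ext_exp {f g : C(Circle, ℝ)} (h : ∀ θ : ℝ, f (Circle.exp θ) = g (Circle.exp θ)) : f = g := by
  ext x
  rw [← Circle.exp_arg x]
  exact h _

lemma continuous_comp_exp (f : C(Circle, ℝ)) : Continuous fun θ : ℝ => f (Circle.exp θ) :=
  f.continuous.comp Circle.exp.continuous

lemma intervalIntegrable_comp_exp (f : C(Circle, ℝ)) (a b : ℝ) :
    IntervalIntegrable (fun θ : ℝ => f (Circle.exp θ)) volume a b :=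
  (continuous_comp_exp f).intervalIntegrable a b

/-- The mean value of a continuous function on the circle. -/
noncomputable def circleMean : C(Circle, ℝ) →L[ℝ] ℝ :=
  LinearMap.mkContinuous
    { toFun := fun f => (2 * π)⁻¹ * ∫ θ in (0 : ℝ)..2 * π, f (Circle.exp θ)
      map_add' := fun f g => by
        simp only [ContinuousMap.add_apply]
        rw [integral_add (intervalIntegrable_comp_exp f _ _) (intervalIntegrable_comp_exp g _ _),
          mul_add]
      map_smul' := fun c f => by
        simp only [ContinuousMap.smul_apply, smul_eq_mul, RingHom.id_apply]
        rw [intervalIntegral.integral_const_mul]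
        ring } 1 (fun f => by
    have h : ‖∫ θ in (0 : ℝ)..2 * π, f (Circle.exp θ)‖ ≤ ‖f‖ * |2 * π - 0| :=
      norm_integral_le_of_norm_le_const fun θ _ => f.norm_coe_le_norm _
    rw [sub_zero, abs_of_pos two_pi_pos] at h
    simp only [LinearMap.coe_mk, AddHom.coe_mk]
    rw [norm_mul, norm_inv, Real.norm_of_nonneg two_pi_pos.le, one_mul, inv_mul_le_iff₀ two_pi_pos]
    linarith)

lemma circleMean_apply (f : C(Circle, ℝ)) :
    circleMean f = (2 * π)⁻¹ * ∫ θ in (0 : ℝ)..2 * π, f (Circle.exp θ) := rfl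

lemma integral_comp_exp (f : C(Circle, ℝ)) :
    ∫ θ in (0 : ℝ)..2 * π, f (Circle.exp θ) = 2 * π * circleMean f := by
  rw [circleMean_apply, mul_inv_cancel_left₀ (by positivity)]

lemma circleMean_const (c : ℝ) : circleMean (ContinuousMap.const _ c) = c := by
  rw [circleMean_apply]
  simp only [ContinuousMap.const_apply, intervalIntegral.integral_const, smul_eq_mul, sub_zero]
  field_simp

lemma periodic_integral_sub_mean (g : C(Circle, ℝ)) :
    Function.Periodic (fun θ : ℝ => ∫ t in (0 : ℝ)..θ, (g (Circle.exp t) - circleMean g))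
      (2 * π) := by
  intro θ
  beta_reduce
  have hc : Continuous fun t : ℝ => g (Circle.exp t) - circleMean g :=
    (continuous_comp_exp g).sub continuous_const
  have hp : Function.Periodic (fun t : ℝ => g (Circle.exp t) - circleMean g) (2 * π) := fun t => by
    simp only [Circle.exp_add_two_pi]
  have h0 : ∫ t in (0 : ℝ)..2 * π, (g (Circle.exp t) - circleMean g) = 0 := by
    rw [integral_sub (intervalIntegrable_comp_exp g _ _) intervalIntegrable_const,
      integral_comp_exp]
    simp
  rw [← integral_add_adjacent_intervals (hc.intervalIntegrable 0 θ) (hc.intervalIntegrable θ _),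
    hp.intervalIntegral_add_eq θ 0, zero_add, h0, add_zero]

lemma continuous_integral_sub_mean (g : C(Circle, ℝ)) :
    Continuous fun θ : ℝ => ∫ t in (0 : ℝ)..θ, (g (Circle.exp t) - circleMean g) := by
  have hc : Continuous fun t : ℝ => g (Circle.exp t) - circleMean g :=
    (continuous_comp_exp g).sub continuous_const
  exact continuous_primitive (fun a b => hc.intervalIntegrable a b) 0

/-- The primitive of `g - circleMean g` that vanishes at `1`. -/
noncomputable def circlePrimitive : C(Circle, ℝ) →L[ℝ] C(Circle, ℝ) :=
  LinearMap.mkContinuous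
    { toFun := fun g => circleLift (fun θ => ∫ t in (0 : ℝ)..θ, (g (Circle.exp t) - circleMean g))
        (continuous_integral_sub_mean g) (periodic_integral_sub_mean g)
      map_add' := fun f g => ext_exp fun θ => by
        have hc (g : C(Circle, ℝ)) : Continuous fun t : ℝ => g (Circle.exp t) - circleMean g :=
          (continuous_comp_exp g).sub continuous_const
        simp only [ContinuousMap.add_apply, circleLift_exp]
        rw [← integral_add ((hc f).intervalIntegrable _ _) ((hc g).intervalIntegrable _ _)]
        congr 1
        ext t
        rw [map_add]
        ring
      map_smul' := fun c f => ext_exp fun θ => by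
        simp only [ContinuousMap.smul_apply, smul_eq_mul, RingHom.id_apply, circleLift_exp]
        rw [← intervalIntegral.integral_const_mul]
        congr 1
        ext t
        rw [map_smul, smul_eq_mul]
        ring } (π * (1 + ‖circleMean‖)) (fun g => by
    have hπ := pi_pos
    rw [ContinuousMap.norm_le _ (by positivity)]
    intro x
    -- Representing the point by its argument in `(-π, π]` makes the interval of integration at most
    -- `π` long.
    rw [← Circle.exp_arg x]
    simp only [LinearMap.coe_mk, AddHom.coe_mk, circleLift_exp]
    have h : ‖∫ t in (0 : ℝ)..Complex.arg x, (g (Circle.exp t) - circleMean g)‖ ≤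
        ((1 + ‖circleMean‖) * ‖g‖) * |Complex.arg x - 0| := by
      refine norm_integral_le_of_norm_le_const fun θ _ => ?_
      refine (norm_sub_le _ _).trans ?_
      have h1 := g.norm_coe_le_norm (Circle.exp θ)
      have h2 := circleMean.le_opNorm g
      linarith
    refine h.trans ?_
    rw [sub_zero, mul_comm π, mul_right_comm]
    gcongr
    exact Complex.abs_arg_le_pi _)

lemma circlePrimitive_exp (g : C(Circle, ℝ)) (θ : ℝ) :
    circlePrimitive g (Circle.exp θ) = ∫ t in (0 : ℝ)..θ, (g (Circle.exp t) - circleMean g) :=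
  circleLift_exp _ (continuous_integral_sub_mean g) (periodic_integral_sub_mean g) θ

/-- The primitive of mean zero of `g - circleMean g`. -/
noncomputable def zeroMeanPrimitive : C(Circle, ℝ) →L[ℝ] C(Circle, ℝ) :=
  circlePrimitive - (ContinuousLinearMap.toSpanSingleton ℝ (1 : C(Circle, ℝ))).comp
    (circleMean.comp circlePrimitive)

lemma zeroMeanPrimitive_apply (g : C(Circle, ℝ)) (x : Circle) :
    zeroMeanPrimitive g x = circlePrimitive g x - circleMean (circlePrimitive g) := by
  simp [zeroMeanPrimitive]

lemma circleMean_zeroMeanPrimitive (g : C(Circle, ℝ)) : circleMean (zeroMeanPrimitive g) = 0 := by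
  have h : zeroMeanPrimitive g =
      circlePrimitive g - ContinuousMap.const _ (circleMean (circlePrimitive g)) := by
    ext x
    exact zeroMeanPrimitive_apply g x
  rw [h, map_sub, circleMean_const, sub_self]

lemma hasDerivAt_zeroMeanPrimitive (g : C(Circle, ℝ)) (θ : ℝ) :
    HasDerivAt (fun t : ℝ => zeroMeanPrimitive g (Circle.exp t))
      (g (Circle.exp θ) - circleMean g) θ := by
  have hc : Continuous fun t : ℝ => g (Circle.exp t) - circleMean g :=
    (continuous_comp_exp g).sub continuous_const
  simp only [zeroMeanPrimitive_apply, circlePrimitive_exp]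
  exact (hc.integral_hasStrictDerivAt 0 θ).hasDerivAt.sub_const _

/-- The cosine of the angle, as a function on the circle. -/
noncomputable def circleCos : C(Circle, ℝ) := ⟨fun x => (x : ℂ).re, by fun_prop⟩

/-- The sine of the angle, as a function on the circle. -/
noncomputable def circleSin : C(Circle, ℝ) := ⟨fun x => (x : ℂ).im, by fun_prop⟩

@[simp] lemma circleCos_exp (θ : ℝ) : circleCos (Circle.exp θ) = cos θ := by
  simp [circleCos, Circle.coe_exp, Complex.exp_ofReal_mul_I_re]

@[simp] lemma circleSin_exp (θ : ℝ) : circleSin (Circle.exp θ) = sin θ := by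
  simp [circleSin, Circle.coe_exp, Complex.exp_ofReal_mul_I_im]

/-- The Fourier coefficient of `cos`. -/
noncomputable def cosCoeff : C(Circle, ℝ) →L[ℝ] ℝ :=
  (2 : ℝ) • circleMean.comp (ContinuousLinearMap.mul ℝ _ circleCos)

/-- The Fourier coefficient of `sin`. -/
noncomputable def sinCoeff : C(Circle, ℝ) →L[ℝ] ℝ :=
  (2 : ℝ) • circleMean.comp (ContinuousLinearMap.mul ℝ _ circleSin)

lemma cosCoeff_apply (f : C(Circle, ℝ)) : cosCoeff f = 2 * circleMean (circleCos * f) := by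
  simp [cosCoeff]

lemma sinCoeff_apply (f : C(Circle, ℝ)) : sinCoeff f = 2 * circleMean (circleSin * f) := by
  simp [sinCoeff]

lemma circleMean_circleCos_mul_self : circleMean (circleCos * circleCos) = 1 / 2 := by
  rw [circleMean_apply]
  simp only [ContinuousMap.mul_apply, circleCos_exp]
  simp only [← sq, integral_cos_sq]
  simp
  field_simp

lemma circleMean_circleSin_mul_self : circleMean (circleSin * circleSin) = 1 / 2 := by
  rw [circleMean_apply]
  simp only [ContinuousMap.mul_apply, circleSin_exp]
  simp only [← sq, integral_sin_sq]
  simp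
  field_simp

lemma circleMean_circleSin_mul_circleCos : circleMean (circleSin * circleCos) = 0 := by
  rw [circleMean_apply]
  simp only [ContinuousMap.mul_apply, circleCos_exp, circleSin_exp, integral_sin_mul_cos₁]
  simp

lemma circleMean_circleCos : circleMean circleCos = 0 := by
  rw [circleMean_apply]
  simp

lemma circleMean_circleSin : circleMean circleSin = 0 := by
  rw [circleMean_apply]
  simp

/-- The part of `f` in the span of `cos` and `sin`. -/
noncomputable def harmonicPart : C(Circle, ℝ) →L[ℝ] C(Circle, ℝ) :=
  (ContinuousLinearMap.toSpanSingleton ℝ circleCos).comp cosCoeff +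
    (ContinuousLinearMap.toSpanSingleton ℝ circleSin).comp sinCoeff

lemma harmonicPart_apply (f : C(Circle, ℝ)) :
    harmonicPart f = cosCoeff f • circleCos + sinCoeff f • circleSin := by
  simp [harmonicPart]

lemma harmonicPart_exp (f : C(Circle, ℝ)) (θ : ℝ) :
    harmonicPart f (Circle.exp θ) = cosCoeff f * cos θ + sinCoeff f * sin θ := by
  simp [harmonicPart_apply]

/-- The part of `f` orthogonal to `cos` and `sin`. -/
noncomputable def nonharmonicPart : C(Circle, ℝ) →L[ℝ] C(Circle, ℝ) :=
  ContinuousLinearMap.id ℝ _ - harmonicPart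

lemma nonharmonicPart_apply (f : C(Circle, ℝ)) : nonharmonicPart f = f - harmonicPart f := rfl

/-- Orthogonality to `cos` and to `sin` is the closing condition: with speed `nonharmonicPart f` the
velocity `(-sin, cos)` times the speed has mean zero, so the primitives in `curveRe` and `curveIm`
have it as derivative with no correction. -/
lemma circleMean_circleCos_mul_nonharmonicPart (f : C(Circle, ℝ)) :
    circleMean (circleCos * nonharmonicPart f) = 0 := by
  rw [nonharmonicPart_apply, harmonicPart_apply, mul_sub, mul_add, mul_smul_comm, mul_smul_comm,
    map_sub, map_add, map_smul, map_smul, circleMean_circleCos_mul_self, mul_comm circleCos,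
    mul_comm circleCos, circleMean_circleSin_mul_circleCos, cosCoeff_apply, mul_comm circleCos]
  simp only [smul_eq_mul]
  ring

lemma circleMean_circleSin_mul_nonharmonicPart (f : C(Circle, ℝ)) :
    circleMean (circleSin * nonharmonicPart f) = 0 := by
  rw [nonharmonicPart_apply, harmonicPart_apply, mul_sub, mul_add, mul_smul_comm, mul_smul_comm,
    map_sub, map_add, map_smul, map_smul, circleMean_circleSin_mul_self,
    circleMean_circleSin_mul_circleCos, sinCoeff_apply]
  simp only [smul_eq_mul]
  ring

/-- The abscissa of the closed curve of mean zero with derivative `nonharmonicPart f * (-sin, cos)`. -/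
noncomputable def curveRe : C(Circle, ℝ) →L[ℝ] C(Circle, ℝ) :=
  zeroMeanPrimitive.comp ((ContinuousLinearMap.mul ℝ _ (-circleSin)).comp nonharmonicPart)

/-- The ordinate of the closed curve of mean zero with derivative `nonharmonicPart f * (-sin, cos)`. -/
noncomputable def curveIm : C(Circle, ℝ) →L[ℝ] C(Circle, ℝ) :=
  zeroMeanPrimitive.comp ((ContinuousLinearMap.mul ℝ _ circleCos).comp nonharmonicPart)

lemma hasDerivAt_curveRe (f : C(Circle, ℝ)) (θ : ℝ) :
    HasDerivAt (fun t : ℝ => curveRe f (Circle.exp t))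
      (nonharmonicPart f (Circle.exp θ) * -sin θ) θ := by
  have h := hasDerivAt_zeroMeanPrimitive (-circleSin * nonharmonicPart f) θ
  have h0 : circleMean (-circleSin * nonharmonicPart f) = 0 := by
    rw [neg_mul, map_neg, circleMean_circleSin_mul_nonharmonicPart, neg_zero]
  rw [h0, sub_zero] at h
  refine h.congr_deriv ?_
  simp [mul_comm]

lemma hasDerivAt_curveIm (f : C(Circle, ℝ)) (θ : ℝ) :
    HasDerivAt (fun t : ℝ => curveIm f (Circle.exp t))
      (nonharmonicPart f (Circle.exp θ) * cos θ) θ := by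
  have h := hasDerivAt_zeroMeanPrimitive (circleCos * nonharmonicPart f) θ
  rw [circleMean_circleCos_mul_nonharmonicPart, sub_zero] at h
  refine h.congr_deriv ?_
  simp [mul_comm]

lemma circleMean_curveRe (f : C(Circle, ℝ)) : circleMean (curveRe f) = 0 :=
  circleMean_zeroMeanPrimitive _

lemma circleMean_curveIm (f : C(Circle, ℝ)) : circleMean (curveIm f) = 0 :=
  circleMean_zeroMeanPrimitive _

lemma cosCoeff_const (c : ℝ) : cosCoeff (ContinuousMap.const _ c) = 0 := by
  have h : circleCos * ContinuousMap.const _ c = c • circleCos := by ext; simp [mul_comm]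
  rw [cosCoeff_apply, h, map_smul, circleMean_circleCos, smul_zero, mul_zero]

lemma sinCoeff_const (c : ℝ) : sinCoeff (ContinuousMap.const _ c) = 0 := by
  have h : circleSin * ContinuousMap.const _ c = c • circleSin := by ext; simp [mul_comm]
  rw [sinCoeff_apply, h, map_smul, circleMean_circleSin, smul_zero, mul_zero]

lemma nonharmonicPart_const (c : ℝ) :
    nonharmonicPart (ContinuousMap.const _ c) = ContinuousMap.const _ c := by
  simp [nonharmonicPart_apply, harmonicPart_apply, cosCoeff_const, sinCoeff_const]

/-- A function on the circle is determined by its mean and its derivative in the angle. -/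
lemma eq_of_hasDerivAt_of_circleMean_eq {f g : C(Circle, ℝ)} {d : ℝ → ℝ}
    (hf : ∀ θ, HasDerivAt (fun t : ℝ => f (Circle.exp t)) (d θ) θ)
    (hg : ∀ θ, HasDerivAt (fun t : ℝ => g (Circle.exp t)) (d θ) θ)
    (h : circleMean f = circleMean g) : f = g := by
  have hd : ∀ θ : ℝ, HasDerivAt (fun t : ℝ => (f - g) (Circle.exp t)) 0 θ := fun θ => by
    have h := (hf θ).sub (hg θ)
    rwa [sub_self] at h
  have hc : f - g = ContinuousMap.const _ ((f - g) (Circle.exp 0)) := ext_exp fun θ =>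
    is_const_of_deriv_eq_zero (fun t => (hd t).differentiableAt) (fun t => (hd t).deriv) θ 0
  have h0 : circleMean (f - g) = 0 := by rw [map_sub, h, sub_self]
  rw [hc, circleMean_const] at h0
  rw [h0] at hc
  rw [← sub_eq_zero, hc]
  rfl

/-- Constant profiles give round circles, the reference curves to which all others are compared. -/
lemma curveRe_const (c : ℝ) : curveRe (ContinuousMap.const _ c) = c • circleCos := by
  refine eq_of_hasDerivAt_of_circleMean_eq (hasDerivAt_curveRe _) (fun θ => ?_) ?_
  · simpa [nonharmonicPart_const] using (hasDerivAt_cos θ).const_mul c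
  · rw [circleMean_curveRe, map_smul, circleMean_circleCos, smul_zero]

lemma curveIm_const (c : ℝ) : curveIm (ContinuousMap.const _ c) = c • circleSin := by
  refine eq_of_hasDerivAt_of_circleMean_eq (hasDerivAt_curveIm _) (fun θ => ?_) ?_
  · simpa [nonharmonicPart_const] using (hasDerivAt_sin θ).const_mul c
  · rw [circleMean_curveIm, map_smul, circleMean_circleSin, smul_zero]

end CircleOperators

/-! ### A calculus of bounded Lipschitz maps. -/

section BoundedLipschitz

variable {P : Type*} [PseudoMetricSpace P]

/-- `g` is bounded and Lipschitz continuous on `S`. -/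
def BddLipOn {E : Type*} [SeminormedAddCommGroup E] (g : P → E) (S : Set P) : Prop :=
  ∃ C : ℝ, 0 ≤ C ∧ (∀ p ∈ S, ‖g p‖ ≤ C) ∧ ∀ p ∈ S, ∀ q ∈ S, ‖g p - g q‖ ≤ C * dist p q

namespace BddLipOn

variable {S : Set P} {E : Type*} [NormedAddCommGroup E]

lemma const (c : E) : BddLipOn (fun _ : P => c) S :=
  ⟨‖c‖, norm_nonneg _, fun _ _ => le_rfl, fun p _ q _ => by
    rw [sub_self, norm_zero]; positivity⟩

lemma add {g h : P → E} (hg : BddLipOn g S) (hh : BddLipOn h S) :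
    BddLipOn (fun p => g p + h p) S := by
  obtain ⟨C, hC, hg1, hg2⟩ := hg
  obtain ⟨D, hD, hh1, hh2⟩ := hh
  refine ⟨C + D, by positivity, fun p hp => ?_, fun p hp q hq => ?_⟩
  · exact (norm_add_le _ _).trans (add_le_add (hg1 p hp) (hh1 p hp))
  · rw [add_sub_add_comm, add_mul]
    exact (norm_add_le _ _).trans (add_le_add (hg2 p hp q hq) (hh2 p hp q hq))

variable [NormedSpace ℝ E]

lemma clm {F : Type*} [NormedAddCommGroup F] [NormedSpace ℝ F] (A : E →L[ℝ] F) {g : P → E}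
    (hg : BddLipOn g S) : BddLipOn (fun p => A (g p)) S := by
  obtain ⟨C, hC, hg1, hg2⟩ := hg
  refine ⟨‖A‖ * C, by positivity, fun p hp => A.le_opNorm_of_le (hg1 p hp), fun p hp q hq => ?_⟩
  rw [← map_sub, mul_assoc]
  exact A.le_opNorm_of_le (hg2 p hp q hq)

lemma sub {g h : P → E} (hg : BddLipOn g S) (hh : BddLipOn h S) :
    BddLipOn (fun p => g p - h p) S := by
  simpa [sub_eq_add_neg] using hg.add (hh.clm (-ContinuousLinearMap.id ℝ E))

lemma bilin {F G : Type*} [NormedAddCommGroup F] [NormedSpace ℝ F] [NormedAddCommGroup G]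
    [NormedSpace ℝ G] (A : E →L[ℝ] F →L[ℝ] G) {g : P → E} {h : P → F} (hg : BddLipOn g S)
    (hh : BddLipOn h S) : BddLipOn (fun p => A (g p) (h p)) S := by
  obtain ⟨C, hC, hg1, hg2⟩ := hg
  obtain ⟨D, hD, hh1, hh2⟩ := hh
  refine ⟨‖A‖ * C * D + ‖A‖ * C * D, by positivity, fun p hp => ?_, fun p hp q hq => ?_⟩
  · have h1 : ‖A (g p) (h p)‖ ≤ ‖A‖ * C * D :=
      (A.le_opNorm₂ _ _).trans (by gcongr; exacts [hg1 p hp, hh1 p hp])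
    have : 0 ≤ ‖A‖ * C * D := by positivity
    linarith
  · have h0 : A (g p) (h p) - A (g q) (h q) = A (g p - g q) (h p) + A (g q) (h p - h q) := by
      simp only [map_sub, _root_.sub_apply]
      abel
    rw [h0]
    have h1 : ‖A (g p - g q) (h p)‖ ≤ ‖A‖ * (C * dist p q) * D :=
      (A.le_opNorm₂ _ _).trans (by gcongr; exacts [hg2 p hp q hq, hh1 p hp])
    have h2 : ‖A (g q) (h p - h q)‖ ≤ ‖A‖ * C * (D * dist p q) :=
      (A.le_opNorm₂ _ _).trans (by gcongr; exacts [hg1 q hq, hh2 p hp q hq])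
    refine (norm_add_le _ _).trans ((add_le_add h1 h2).trans (le_of_eq ?_))
    ring

lemma mul {R : Type*} [NormedRing R] [NormedAlgebra ℝ R] {g h : P → R} (hg : BddLipOn g S)
    (hh : BddLipOn h S) : BddLipOn (fun p => g p * h p) S :=
  hg.bilin (ContinuousLinearMap.mul ℝ R) hh

lemma smul {g : P → ℝ} {h : P → E} (hg : BddLipOn g S) (hh : BddLipOn h S) :
    BddLipOn (fun p => g p • h p) S :=
  hg.bilin (ContinuousLinearMap.lsmul ℝ ℝ) hh

lemma inv {g : P → ℝ} {c : ℝ} (hc : 0 < c) (hg : BddLipOn g S) (hgc : ∀ p ∈ S, c ≤ g p) :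
    BddLipOn (fun p => (g p)⁻¹) S := by
  obtain ⟨C, hC, -, hg2⟩ := hg
  refine ⟨c⁻¹ + C * (c * c)⁻¹, by positivity, fun p hp => ?_, fun p hp q hq => ?_⟩
  · have h1 : ‖(g p)⁻¹‖ ≤ c⁻¹ := by
      rw [norm_inv, Real.norm_of_nonneg (hc.le.trans (hgc p hp))]
      exact inv_anti₀ hc (hgc p hp)
    have : 0 ≤ C * (c * c)⁻¹ := by positivity
    linarith
  · have hp0 := hc.trans_le (hgc p hp)
    have hq0 := hc.trans_le (hgc q hq)
    have h1 : (g p)⁻¹ - (g q)⁻¹ = (g q - g p) * (g p * g q)⁻¹ := by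
      field_simp
    have h2 : ‖(g p * g q)⁻¹‖ ≤ (c * c)⁻¹ := by
      rw [norm_inv, Real.norm_of_nonneg (by positivity)]
      exact inv_anti₀ (by positivity) (mul_le_mul (hgc p hp) (hgc q hq) hc.le hp0.le)
    have h3 := hg2 q hq p hp
    rw [h1, norm_mul]
    calc ‖g q - g p‖ * ‖(g p * g q)⁻¹‖ ≤ (C * dist q p) * (c * c)⁻¹ := by gcongr
      _ ≤ (c⁻¹ + C * (c * c)⁻¹) * dist p q := by
        rw [dist_comm q p, add_mul]
        have : 0 ≤ c⁻¹ * dist p q := by positivity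
        linarith

/-- Superposition with a bounded Lipschitz function of the plane. -/
lemma superposition {κ : C(ℂ, ℝ)} {M L : ℝ} (hM : ∀ z, |κ z| ≤ M)
    (hL : ∀ z w, |κ z - κ w| ≤ L * ‖z - w‖) {c : P → C(Circle, ℂ)} {a b : P → C(Circle, ℝ)}
    (hc : ∀ p x, c p x = ⟨a p x, b p x⟩) (ha : BddLipOn a S) (hb : BddLipOn b S) :
    BddLipOn (fun p => κ.comp (c p)) S := by
  obtain ⟨C, hC, -, ha2⟩ := ha
  obtain ⟨D, hD, -, hb2⟩ := hb
  have hM0 : 0 ≤ M := (abs_nonneg _).trans (hM 0)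
  have hL0 : 0 ≤ L := by simpa using (abs_nonneg _).trans (hL 1 0)
  refine ⟨M + L * (C + D), by positivity, fun p _ => ?_, fun p hp q hq => ?_⟩
  · rw [ContinuousMap.norm_le _ (by positivity)]
    intro x
    have : 0 ≤ L * (C + D) := by positivity
    exact (hM _).trans (by linarith)
  · rw [ContinuousMap.norm_le _ (by positivity)]
    intro x
    have h1 : |a p x - a q x| ≤ C * dist p q :=
      ((a p - a q).norm_coe_le_norm x).trans (ha2 p hp q hq)
    have h2 : |b p x - b q x| ≤ D * dist p q :=
      ((b p - b q).norm_coe_le_norm x).trans (hb2 p hp q hq)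
    refine (hL _ _).trans ?_
    have h3 : ‖c p x - c q x‖ ≤ (C + D) * dist p q := by
      refine (Complex.norm_le_abs_re_add_abs_im _).trans ?_
      simp only [Complex.sub_re, Complex.sub_im, hc]
      linarith
    have : 0 ≤ M * dist p q := by positivity
    have := mul_le_mul_of_nonneg_left h3 hL0
    linarith

end BddLipOn

end BoundedLipschitz

/-! ### The fixed point equation for the profile. -/

section Profile

/-- The curve `z + s (curveRe f, curveIm f)`, as a function on the circle. -/
noncomputable def profileCurve (s : ℝ) (z : ℂ) (f : C(Circle, ℝ)) : C(Circle, ℂ) :=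
  ⟨fun x => z + s * (curveRe f x + curveIm f x * Complex.I), by fun_prop⟩

/-- The nonlinear part of the equation for the profile. -/
noncomputable def profileMap (κ : C(ℂ, ℝ)) (s ε : ℝ) (z : ℂ) (f : C(Circle, ℝ)) : C(Circle, ℝ) :=
  curveIm f
    -- With `v = z₂ + s curveIm f`, the last two factors times `s` are `v² - z₂²`. Hence `f = z₂ + s
    -- profileMap f` says that `v - z₂⁻² v² harmonicPart f = nonharmonicPart f (1 + s (ε κ + sin))`:
    -- one unknown carries both the speed and the multiplier.
    - (z.im * z.im)⁻¹ • (harmonicPart f * curveIm f * ((2 * z.im) • 1 + s • curveIm f))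
    - (ε • κ.comp (profileCurve s z f) + circleSin) * nonharmonicPart f

lemma bddLipOn_profileMap {κ : C(ℂ, ℝ)} {M L : ℝ} (hM : ∀ z, |κ z| ≤ M)
    (hL : ∀ z w, |κ z - κ w| ≤ L * ‖z - w‖) {Z : Set ℂ} {B y₀ : ℝ} (hB : ∀ z ∈ Z, ‖z‖ ≤ B)
    (hy₀ : 0 < y₀) (hy : ∀ z ∈ Z, y₀ ≤ z.im) (R : ℝ) :
    BddLipOn (fun p : ℝ × ℝ × ℂ × C(Circle, ℝ) => profileMap κ p.1 p.2.1 p.2.2.1 p.2.2.2)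
      {p | |p.1| ≤ 1 ∧ |p.2.1| ≤ 1 ∧ p.2.2.1 ∈ Z ∧ ‖p.2.2.2‖ ≤ R} := by
  set S : Set (ℝ × ℝ × ℂ × C(Circle, ℝ)) :=
    {p | |p.1| ≤ 1 ∧ |p.2.1| ≤ 1 ∧ p.2.2.1 ∈ Z ∧ ‖p.2.2.2‖ ≤ R}
  have hs : BddLipOn (fun p : ℝ × ℝ × ℂ × C(Circle, ℝ) => p.1) S :=
    ⟨1, zero_le_one, fun p hp => hp.1, fun p _ q _ => by
      rw [one_mul, ← dist_eq_norm]; exact le_max_left _ _⟩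
  have hε : BddLipOn (fun p : ℝ × ℝ × ℂ × C(Circle, ℝ) => p.2.1) S :=
    ⟨1, zero_le_one, fun p hp => hp.2.1, fun p _ q _ => by
      rw [one_mul, ← dist_eq_norm]; exact (le_max_left _ _).trans (le_max_right _ _)⟩
  have hz : BddLipOn (fun p : ℝ × ℝ × ℂ × C(Circle, ℝ) => p.2.2.1) S :=
    ⟨max B 1, by positivity, fun p hp => (hB _ hp.2.2.1).trans (le_max_left _ _), fun p _ q _ => by
      rw [← dist_eq_norm]
      refine (show dist p.2.2.1 q.2.2.1 ≤ dist p q from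
        (le_max_left _ _).trans ((le_max_right _ _).trans (le_max_right _ _))).trans ?_
      exact le_mul_of_one_le_left dist_nonneg (le_max_right _ _)⟩
  have hf : BddLipOn (fun p : ℝ × ℝ × ℂ × C(Circle, ℝ) => p.2.2.2) S :=
    ⟨max R 1, by positivity, fun p hp => hp.2.2.2.trans (le_max_left _ _), fun p _ q _ => by
      rw [← dist_eq_norm]
      refine (show dist p.2.2.2 q.2.2.2 ≤ dist p q from
        (le_max_right _ _).trans ((le_max_right _ _).trans (le_max_right _ _))).trans ?_
      exact le_mul_of_one_le_left dist_nonneg (le_max_right _ _)⟩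
  have hx : BddLipOn (fun p : ℝ × ℝ × ℂ × C(Circle, ℝ) => p.2.2.1.re) S := hz.clm Complex.reCLM
  have hy' : BddLipOn (fun p : ℝ × ℝ × ℂ × C(Circle, ℝ) => p.2.2.1.im) S := hz.clm Complex.imCLM
  have hJ := hf.clm curveIm
  have h1 : BddLipOn (fun p : ℝ × ℝ × ℂ × C(Circle, ℝ) => (p.2.2.1.im * p.2.2.1.im)⁻¹) S :=
    (hy'.mul hy').inv (mul_pos hy₀ hy₀) fun p hp =>
      mul_self_le_mul_self hy₀.le (hy _ hp.2.2.1)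
  have ha : BddLipOn (fun p : ℝ × ℝ × ℂ × C(Circle, ℝ) =>
      p.2.2.1.re • (1 : C(Circle, ℝ)) + p.1 • curveRe p.2.2.2) S :=
    (hx.smul (BddLipOn.const _)).add (hs.smul (hf.clm curveRe))
  have hb : BddLipOn (fun p : ℝ × ℝ × ℂ × C(Circle, ℝ) =>
      p.2.2.1.im • (1 : C(Circle, ℝ)) + p.1 • curveIm p.2.2.2) S :=
    (hy'.smul (BddLipOn.const _)).add (hs.smul hJ)
  have hκ : BddLipOn (fun p : ℝ × ℝ × ℂ × C(Circle, ℝ) =>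
      κ.comp (profileCurve p.1 p.2.2.1 p.2.2.2)) S :=
    BddLipOn.superposition hM hL (fun p x => by
      apply Complex.ext <;> simp [profileCurve]) ha hb
  exact (hJ.sub (h1.smul (((hf.clm harmonicPart).mul hJ).mul
    ((((BddLipOn.const 2).mul hy').smul (BddLipOn.const 1)).add (hs.smul hJ))))).sub
      (((hε.smul hκ).add (BddLipOn.const _)).mul (hf.clm nonharmonicPart))

/-- Solutions of the profile equation, uniformly for small `s`, with Lipschitz dependence on the
centre `z`. -/
theorem exists_profile {κ : C(ℂ, ℝ)} {M L : ℝ} (hM : ∀ z, |κ z| ≤ M)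
    (hL : ∀ z w, |κ z - κ w| ≤ L * ‖z - w‖) {Z : Set ℂ} {B y₀ : ℝ} (hB : ∀ z ∈ Z, ‖z‖ ≤ B)
    (hy₀ : 0 < y₀) (hy : ∀ z ∈ Z, y₀ ≤ z.im) :
    ∃ s₀ > 0, ∃ C ≥ 0, ∀ s ε : ℝ, 0 < s → s < s₀ → |ε| ≤ 1 → ∃ f : ℂ → C(Circle, ℝ),
      (∀ z ∈ Z, f z = ContinuousMap.const _ z.im + s • profileMap κ s ε z (f z)) ∧
      (∀ z ∈ Z, ‖f z - ContinuousMap.const _ z.im‖ ≤ C * s) ∧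
      ∀ z ∈ Z, ∀ w ∈ Z, ‖f w - f z‖ ≤ 3 * ‖w - z‖ := by
  obtain ⟨C, hC, hC1, hC2⟩ := bddLipOn_profileMap hM hL hB hy₀ hy (B + 1)
  -- This gives `s C ≤ 1/2`, so that the fixed point map is a `1/2`-contraction of the ball of
  -- radius `B + 1` into itself.
  refine ⟨min 1 (1 / (2 * (C + 1))), by positivity, C, hC, fun s ε hs hs₀ hε => ?_⟩
  have hs1 : s ≤ 1 := (hs₀.trans_le (min_le_left _ _)).le
  have hsC : s * C ≤ 1 / 2 := by
    have h := (hs₀.trans_le (min_le_right _ _)).le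
    rw [le_div_iff₀ (by positivity)] at h
    nlinarith
  have hsabs : |s| ≤ 1 := by rwa [abs_of_pos hs]
  have hconst (a b : ℝ) : ‖(ContinuousMap.const Circle a - ContinuousMap.const Circle b)‖ ≤ |a - b| :=
    (ContinuousMap.norm_le _ (abs_nonneg _)).2 fun x => le_rfl
  have hbound : ∀ z ∈ Z, ∀ f : C(Circle, ℝ), ‖f‖ ≤ B + 1 → ‖s • profileMap κ s ε z f‖ ≤ C * s := by
    intro z hz f hf
    rw [norm_smul, Real.norm_of_nonneg hs.le, mul_comm]
    exact mul_le_mul_of_nonneg_right (hC1 (s, ε, z, f) ⟨hsabs, hε, hz, hf⟩) hs.le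
  have hlip : ∀ z ∈ Z, ∀ w ∈ Z, ∀ f g : C(Circle, ℝ), ‖f‖ ≤ B + 1 → ‖g‖ ≤ B + 1 →
      ‖s • profileMap κ s ε z f - s • profileMap κ s ε w g‖ ≤ 1 / 2 * max ‖z - w‖ ‖f - g‖ := by
    intro z hz w hw f g hf hg
    have h := hC2 (s, ε, z, f) ⟨hsabs, hε, hz, hf⟩ (s, ε, w, g) ⟨hsabs, hε, hw, hg⟩
    have hd : dist (s, ε, z, f) (s, ε, w, g) = max ‖z - w‖ ‖f - g‖ := by
      simp [dist_eq_norm]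
    rw [hd] at h
    rw [← smul_sub, norm_smul, Real.norm_of_nonneg hs.le]
    calc s * ‖profileMap κ s ε z f - profileMap κ s ε w g‖
        ≤ s * (C * max ‖z - w‖ ‖f - g‖) := by gcongr
      _ = s * C * max ‖z - w‖ ‖f - g‖ := by ring
      _ ≤ _ := by gcongr
  have hex : ∀ z ∈ Z, ∃ f : C(Circle, ℝ), ‖f‖ ≤ B + 1 ∧
      f = ContinuousMap.const _ z.im + s • profileMap κ s ε z f := by
    intro z hz
    set N : C(Circle, ℝ) → C(Circle, ℝ) := fun f =>
      ContinuousMap.const _ z.im + s • profileMap κ s ε z f with hN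
    have hB0 : 0 ≤ B := (norm_nonneg _).trans (hB z hz)
    have hmaps : Set.MapsTo N (Metric.closedBall 0 (B + 1)) (Metric.closedBall 0 (B + 1)) := by
      intro f hf
      rw [mem_closedBall_zero_iff] at hf ⊢
      have h1 := hbound z hz f hf
      have h2 : ‖(ContinuousMap.const Circle z.im)‖ ≤ B :=
        (ContinuousMap.norm_le _ hB0).2 fun x => (Complex.abs_im_le_norm z).trans (hB z hz)
      refine (norm_add_le _ _).trans ?_
      linarith
    have hcontr : ContractingWith (1 / 2) (hmaps.restrict N _ _) := by
      refine ⟨by norm_num, LipschitzWith.of_dist_le_mul fun f g => ?_⟩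
      rw [Subtype.dist_eq, Subtype.dist_eq, dist_eq_norm, dist_eq_norm]
      have h := hlip z hz z hz f g (mem_closedBall_zero_iff.1 f.2) (mem_closedBall_zero_iff.1 g.2)
      rw [sub_self, norm_zero, max_eq_right (norm_nonneg _)] at h
      simpa [hN] using h
    obtain ⟨f, hf, hfix, -⟩ := hcontr.exists_fixedPoint' Metric.isClosed_closedBall.isComplete hmaps
      (Metric.mem_closedBall_self (by linarith)) (edist_ne_top _ _)
    exact ⟨f, mem_closedBall_zero_iff.1 hf, hfix.symm⟩
  choose! f hf hfix using hex
  refine ⟨f, hfix, fun z hz => ?_, fun z hz w hw => ?_⟩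
  · rw [sub_eq_of_eq_add' (hfix z hz)]
    exact hbound z hz _ (hf z hz)
  · have h1 := hlip w hw z hz (f w) (f z) (hf w hw) (hf z hz)
    have h2 := hconst w.im z.im
    have h3 : |w.im - z.im| ≤ ‖w - z‖ := by simpa using Complex.abs_im_le_norm (w - z)
    have h4 : ‖f w - f z‖ ≤ ‖w - z‖ + 1 / 2 * max ‖w - z‖ ‖f w - f z‖ := by
      conv_lhs => rw [hfix w hw, hfix z hz, add_sub_add_comm]
      exact (norm_add_le _ _).trans (by linarith)
    have h5 := norm_nonneg (w - z)
    -- With `d = ‖w - z‖` and `N = ‖f w - f z‖`, the bound reads `N ≤ d + (d + N) / 2`; this is the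
    -- origin of the constant `3`.
    have h6 : max ‖w - z‖ ‖f w - f z‖ ≤ ‖w - z‖ + ‖f w - f z‖ :=
      max_le_add_of_nonneg h5 (norm_nonneg _)
    linarith

end Profile

/-! ### Integral identities for curves parametrized by the angle of the normal. -/

section AngleCurves

open Real MeasureTheory intervalIntegral

/-- A closed plane curve `(u, v)` parametrized by the angle of its normal: its derivative is
`r (-sin, cos)`. -/
structure IsAngleCurve (r u v : ℝ → ℝ) : Prop where
  continuous_speed : Continuous r
  hasDerivAt_fst : ∀ θ, HasDerivAt u (-(r θ * sin θ)) θ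
  hasDerivAt_snd : ∀ θ, HasDerivAt v (r θ * cos θ) θ
  fst_closed : u (2 * π) = u 0
  snd_closed : v (2 * π) = v 0

lemma integral_deriv_eq_zero {F F' : ℝ → ℝ} (hF : ∀ θ, HasDerivAt F (F' θ) θ) (hF' : Continuous F')
    (h : F (2 * π) = F 0) : ∫ θ in (0 : ℝ)..2 * π, F' θ = 0 := by
  rw [integral_eq_sub_of_hasDerivAt (fun θ _ => hF θ) (hF'.intervalIntegrable _ _), h, sub_self]

/-- The identities below are integrations by parts; each is reduced here to displaying a periodic
primitive of the difference of the integrands. -/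
lemma integral_eq_of_hasDerivAt_sub {F f g : ℝ → ℝ} (hF : ∀ θ, HasDerivAt F (f θ - g θ) θ)
    (hf : Continuous f) (hg : Continuous g) (h : F (2 * π) = F 0) :
    ∫ θ in (0 : ℝ)..2 * π, f θ = ∫ θ in (0 : ℝ)..2 * π, g θ := by
  have h0 := integral_deriv_eq_zero hF (hf.sub hg) h
  rwa [integral_sub (hf.intervalIntegrable _ _) (hg.intervalIntegrable _ _), sub_eq_zero] at h0

namespace IsAngleCurve

variable {r u v : ℝ → ℝ}

lemma continuous_fst (h : IsAngleCurve r u v) : Continuous u :=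
  continuous_iff_continuousAt.2 fun θ => (h.hasDerivAt_fst θ).continuousAt

lemma continuous_snd (h : IsAngleCurve r u v) : Continuous v :=
  continuous_iff_continuousAt.2 fun θ => (h.hasDerivAt_snd θ).continuousAt

lemma sub {r' u' v' : ℝ → ℝ} (h : IsAngleCurve r u v) (h' : IsAngleCurve r' u' v') :
    IsAngleCurve (fun θ => r' θ - r θ) (fun θ => u' θ - u θ) (fun θ => v' θ - v θ) where
  continuous_speed := h'.continuous_speed.sub h.continuous_speed
  hasDerivAt_fst θ := ((h'.hasDerivAt_fst θ).sub (h.hasDerivAt_fst θ)).congr_deriv (by ring)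
  hasDerivAt_snd θ := ((h'.hasDerivAt_snd θ).sub (h.hasDerivAt_snd θ)).congr_deriv (by ring)
  fst_closed := by rw [h.fst_closed, h'.fst_closed]
  snd_closed := by rw [h.snd_closed, h'.snd_closed]

/-- Integral of a first harmonic against the support function of a closed curve. -/
lemma integral_harmonic_mul_support (h : IsAngleCurve r u v) (a b : ℝ) :
    ∫ θ in (0 : ℝ)..2 * π, (a * cos θ + b * sin θ) * (u θ * cos θ + v θ * sin θ) =
      (a * ∫ θ in (0 : ℝ)..2 * π, u θ) / 2 + (b * ∫ θ in (0 : ℝ)..2 * π, v θ) / 2 := by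
  have hu := h.continuous_fst
  have hv := h.continuous_snd
  have h1 : ∫ θ in (0 : ℝ)..2 * π, (a * cos θ + b * sin θ) * (u θ * cos θ + v θ * sin θ) =
      ∫ θ in (0 : ℝ)..2 * π, (a / 2 * u θ + b / 2 * v θ) := by
    -- After removal of `(a u + b v) / 2` the integrand pairs `u`, `v` with `cos 2θ`, `sin 2θ`.
    -- Integrating these by parts leaves multiples of `r cos θ = v'` and `-r sin θ = u'`, which
    -- account for the last term of the primitive.
    refine integral_eq_of_hasDerivAt_sub (F := fun θ =>
      ((a * u θ - b * v θ) * (sin θ * cos θ) - (a * v θ + b * u θ) * (cos θ ^ 2 - 1 / 2)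
        + (a * v θ - b * u θ) / 2) / 2) (fun θ => ?_) (by fun_prop) (by fun_prop) ?_
    · have hs := hasDerivAt_sin θ
      have hc := hasDerivAt_cos θ
      have hu' := h.hasDerivAt_fst θ
      have hv' := h.hasDerivAt_snd θ
      refine ((((((hu'.const_mul a).sub (hv'.const_mul b)).mul (hs.mul hc)).sub
        (((hv'.const_mul a).add (hu'.const_mul b)).mul ((hc.pow 2).sub_const (1 / 2)))).add
        (((hv'.const_mul a).sub (hu'.const_mul b)).div_const 2)).div_const 2).congr_deriv ?_
      simp only [Pi.sub_apply, Pi.add_apply, Pi.mul_apply, Pi.pow_apply]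
      have hsc := sin_sq_add_cos_sq θ
      push_cast
      have e : sin θ ^ 2 = 1 - cos θ ^ 2 := by linarith
      ring_nf
      simp only [e]
      ring
    · simp only [h.fst_closed, h.snd_closed, sin_two_pi, cos_two_pi, sin_zero, cos_zero]
  rw [h1, integral_add ((hu.const_mul _).intervalIntegrable _ _)
    ((hv.const_mul _).intervalIntegrable _ _), intervalIntegral.integral_const_mul,
    intervalIntegral.integral_const_mul]
  ring

/-- Horizontal translations preserve the area `dx dy / y²`, so their flux through a closed curve
vanishes. The next lemma is the same fact for dilations, whose normal component is the support
function. -/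
lemma integral_flux_translation (h : IsAngleCurve r u v) (hv : ∀ θ, 0 < v θ) :
    ∫ θ in (0 : ℝ)..2 * π, r θ * cos θ / v θ ^ 2 = 0 := by
  have hr := h.continuous_speed
  have hvc := h.continuous_snd
  refine integral_deriv_eq_zero (F := fun θ => -(v θ)⁻¹) (fun θ => ?_)
    (Continuous.div (by fun_prop) (by fun_prop) fun θ => (pow_pos (hv θ) 2).ne') ?_
  · refine ((h.hasDerivAt_snd θ).fun_inv (hv θ).ne').fun_neg.congr_deriv ?_
    ring
  · simp only [h.snd_closed]

lemma integral_flux_dilation (h : IsAngleCurve r u v) (hv : ∀ θ, 0 < v θ) :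
    ∫ θ in (0 : ℝ)..2 * π, r θ * (u θ * cos θ + v θ * sin θ) / v θ ^ 2 = 0 := by
  have hr := h.continuous_speed
  have huc := h.continuous_fst
  have hvc := h.continuous_snd
  refine integral_deriv_eq_zero (F := fun θ => -(u θ / v θ)) (fun θ => ?_)
    (Continuous.div (by fun_prop) (by fun_prop) fun θ => (pow_pos (hv θ) 2).ne') ?_
  · refine ((h.hasDerivAt_fst θ).fun_div (h.hasDerivAt_snd θ) (hv θ).ne').fun_neg.congr_deriv ?_
    ring
  · simp only [h.fst_closed, h.snd_closed]

section Multiplier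

variable {a b k ε : ℝ} {γ : ℝ → ℝ}

/-- Invariance under translations. -/
lemma integral_multiplier_translation (h : IsAngleCurve r u v) (hv : ∀ θ, 0 < v θ)
    (hγ : Continuous γ)
    (heq : ∀ θ, v θ - (a * cos θ + b * sin θ) * v θ ^ 2 =
      r θ * (k + ε * (γ θ * v θ ^ 2) + sin θ)) :
    π * a = -(ε * ∫ θ in (0 : ℝ)..2 * π, γ θ * (r θ * cos θ)) := by
  have hr := h.continuous_speed
  have hvc := h.continuous_snd
  have h1 : ∫ θ in (0 : ℝ)..2 * π, -(ε * (γ θ * (r θ * cos θ))) =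
      ∫ θ in (0 : ℝ)..2 * π, (a * cos θ + b * sin θ) * cos θ := by
    -- The primitive is the Noether quantity of the equation with constant curvature `k`, for
    -- translations; only the `ε` term and the multiplier survive.
    refine integral_eq_of_hasDerivAt_sub (F := fun θ => -(sin θ + k) / v θ) (fun θ => ?_)
      (by fun_prop) (by fun_prop) ?_
    · have hvθ := (hv θ).ne'
      refine (((hasDerivAt_sin θ).add_const k).fun_neg.fun_div
        (h.hasDerivAt_snd θ) hvθ).congr_deriv ?_
      rw [div_eq_iff (pow_ne_zero 2 hvθ)]
      linear_combination (-cos θ) * heq θ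
    · simp only [h.snd_closed, sin_two_pi, sin_zero]
  have h2 : ∫ θ in (0 : ℝ)..2 * π, (a * cos θ + b * sin θ) * cos θ = π * a := by
    have : ∀ θ, (a * cos θ + b * sin θ) * cos θ = a * cos θ ^ 2 + b * (sin θ * cos θ) :=
      fun θ => by ring
    simp only [this]
    rw [integral_add (Continuous.intervalIntegrable (by fun_prop) _ _)
      (Continuous.intervalIntegrable (by fun_prop) _ _), intervalIntegral.integral_const_mul,
      intervalIntegral.integral_const_mul, integral_cos_sq, integral_sin_mul_cos₁]
    simp
    ring
  rw [← h2, ← h1, intervalIntegral.integral_neg, intervalIntegral.integral_const_mul]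

/-- Invariance under dilations. -/
lemma integral_multiplier_dilation (h : IsAngleCurve r u v) (hv : ∀ θ, 0 < v θ)
    (hγ : Continuous γ)
    (heq : ∀ θ, v θ - (a * cos θ + b * sin θ) * v θ ^ 2 =
      r θ * (k + ε * (γ θ * v θ ^ 2) + sin θ)) :
    (a * ∫ θ in (0 : ℝ)..2 * π, u θ) / 2 + (b * ∫ θ in (0 : ℝ)..2 * π, v θ) / 2 =
      -(ε * ∫ θ in (0 : ℝ)..2 * π, γ θ * (r θ * (u θ * cos θ + v θ * sin θ))) := by
  have hr := h.continuous_speed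
  have huc := h.continuous_fst
  have hvc := h.continuous_snd
  have h1 : ∫ θ in (0 : ℝ)..2 * π, -(ε * (γ θ * (r θ * (u θ * cos θ + v θ * sin θ)))) =
      ∫ θ in (0 : ℝ)..2 * π, (a * cos θ + b * sin θ) * (u θ * cos θ + v θ * sin θ) := by
    -- The Noether quantity for dilations: the tangential part of the position over `v`, minus `k u
    -- / v`.
    refine integral_eq_of_hasDerivAt_sub (F := fun θ =>
      (u θ * -sin θ + v θ * cos θ - k * u θ) / v θ) (fun θ => ?_) (by fun_prop) (by fun_prop) ?_
    · have hvθ := (hv θ).ne'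
      have hu' := h.hasDerivAt_fst θ
      have hv' := h.hasDerivAt_snd θ
      refine ((((hu'.fun_mul (hasDerivAt_sin θ).fun_neg).fun_add
        (hv'.fun_mul (hasDerivAt_cos θ))).fun_sub (hu'.const_mul k)).fun_div hv' hvθ).congr_deriv ?_
      rw [div_eq_iff (pow_ne_zero 2 hvθ)]
      linear_combination (-(u θ * cos θ + v θ * sin θ)) * heq θ
    · simp only [h.fst_closed, h.snd_closed, sin_two_pi, sin_zero, cos_two_pi, cos_zero]
  rw [← h.integral_harmonic_mul_support, ← h1, intervalIntegral.integral_neg,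
    intervalIntegral.integral_const_mul]

/-- First variation of the length and of the weighted area in the direction of a closed curve with
the same normals. -/
lemma integral_first_variation (h : IsAngleCurve r u v) (hv : ∀ θ, 0 < v θ) (hγ : Continuous γ)
    (heq : ∀ θ, v θ - (a * cos θ + b * sin θ) * v θ ^ 2 =
      r θ * (k + ε * (γ θ * v θ ^ 2) + sin θ))
    {q qx : ℝ → ℝ} (hqx : Continuous qx)
    (hq : ∀ θ, HasDerivAt q (-(qx θ * (r θ * sin θ)) - γ θ * (r θ * cos θ)) θ)
    (hq_closed : q (2 * π) = q 0)
    {σ φ ψ : ℝ → ℝ} (hφ : IsAngleCurve σ φ ψ) :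
    ∫ θ in (0 : ℝ)..2 * π, (σ θ / v θ - r θ * ψ θ / v θ ^ 2 +
        sin θ * (σ θ * (k / v θ + ε * q θ) +
          r θ * (-(k * ψ θ / v θ ^ 2) + ε * (qx θ * φ θ - γ θ * ψ θ)))) =
      (a * ∫ θ in (0 : ℝ)..2 * π, φ θ) / 2 + (b * ∫ θ in (0 : ℝ)..2 * π, ψ θ) / 2 := by
  have hr := h.continuous_speed
  have huc := h.continuous_fst
  have hvc := h.continuous_snd
  have hσ := hφ.continuous_speed
  have hφc := hφ.continuous_fst
  have hψc := hφ.continuous_snd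
  have hqc : Continuous q := continuous_iff_continuousAt.2 fun θ => (hq θ).continuousAt
  have hv0 : ∀ θ, v θ ≠ 0 := fun θ => (hv θ).ne'
  have hv1 : ∀ θ, v θ ^ 2 ≠ 0 := fun θ => pow_ne_zero 2 (hv0 θ)
  rw [← hφ.integral_harmonic_mul_support]
  -- The boundary terms of the first variation: the tangential component of `(φ, ψ)` from the
  -- length, and the potential times `φ` from the area written as `∮ (k / y + ε q) dx`.
  refine integral_eq_of_hasDerivAt_sub (F := fun θ =>
    (φ θ * -sin θ + ψ θ * cos θ) / v θ - (k / v θ + ε * q θ) * φ θ) (fun θ => ?_)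
    (by fun_prop (disch := assumption)) (by fun_prop) ?_
  · have hvθ := hv0 θ
    have hφ' := hφ.hasDerivAt_fst θ
    have hψ' := hφ.hasDerivAt_snd θ
    have hv' := h.hasDerivAt_snd θ
    refine ((((hφ'.fun_mul (hasDerivAt_sin θ).fun_neg).fun_add
      (hψ'.fun_mul (hasDerivAt_cos θ))).fun_div hv' hvθ).fun_sub
      ((((hasDerivAt_const θ k).fun_div hv' hvθ).fun_add ((hq θ).const_mul ε)).fun_mul
        hφ')).congr_deriv ?_
    have hsc := sin_sq_add_cos_sq θ
    have hθ := heq θ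
    have hvw : v θ * (v θ)⁻¹ = 1 := mul_inv_cancel₀ hvθ
    simp only [div_eq_mul_inv, ← inv_pow]
    generalize (v θ)⁻¹ = w at hvw
    -- The multiplier equation divided by `v²`: the gradient of the energy in the normal direction
    -- is `a cos + b sin`.
    have hm : a * cos θ + b * sin θ =
        w - r θ * w ^ 2 * (k + sin θ) - ε * γ θ * r θ := by
      linear_combination (-w ^ 2) * hθ +
        (w - (a * cos θ + b * sin θ + r θ * ε * γ θ) * (v θ * w + 1)) * hvw
    linear_combination (φ θ * cos θ + ψ θ * sin θ) * hm +
      (σ θ * w * (sin θ ^ 2 + cos θ ^ 2) - (φ θ * cos θ + ψ θ * sin θ) * w) * hvw +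
      (σ θ * w - r θ * ψ θ * w ^ 2) * hsc
  · simp only [hφ.fst_closed, hφ.snd_closed, h.snd_closed, hq_closed, sin_two_pi, sin_zero,
      cos_two_pi, cos_zero]

end Multiplier

end IsAngleCurve

end AngleCurves

/-! ### Uniform first order expansions. -/

section Taylor

variable {E : Type*} [NormedAddCommGroup E] [NormedSpace ℝ E]

/-- First order Taylor expansion, uniformly on a compact convex set. -/
lemma exists_taylor_bound {f : E → ℝ} {U D : Set E} (hU : IsOpen U) (hf : ContDiffOn ℝ 1 f U)
    (hD : IsCompact D) (hconv : Convex ℝ D) (hDU : D ⊆ U) {η : ℝ} (hη : 0 < η) :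
    ∃ δ > 0, ∀ x ∈ D, ∀ y ∈ D, ‖y - x‖ < δ →
      |f y - f x - fderiv ℝ f x (y - x)| ≤ η * ‖y - x‖ := by
  have hc : ContinuousOn (fderiv ℝ f) D := (hf.continuousOn_fderiv_of_isOpen hU le_rfl).mono hDU
  obtain ⟨δ, hδ, h⟩ := Metric.uniformContinuousOn_iff.1
    (hD.uniformContinuousOn_of_continuous hc) η hη
  refine ⟨δ, hδ, fun x hx y hy hxy => ?_⟩
  have hsub : segment ℝ x y ⊆ D := hconv.segment_subset hx hy
  refine (convex_segment x y).norm_image_sub_le_of_norm_fderiv_le' (𝕜 := ℝ) (f := f)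
    (φ := fderiv ℝ f x) (C := η)
    (fun w hw => ?_) (fun w hw => ?_) (left_mem_segment ℝ x y) (right_mem_segment ℝ x y)
  · exact (hf.differentiableOn one_ne_zero).differentiableAt (hU.mem_nhds (hDU (hsub hw)))
  · rw [← dist_eq_norm]
    refine (h w (hsub hw) x hx ?_).le
    rw [dist_eq_norm]
    refine lt_of_le_of_lt ?_ hxy
    obtain ⟨t, ht, rfl⟩ := (segment_eq_image' ℝ x y ▸ hw :)
    rw [add_sub_cancel_left, norm_smul, Real.norm_of_nonneg ht.1]
    exact mul_le_of_le_one_left (norm_nonneg _) ht.2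

/-- First order expansion of `(ρ, x) ↦ ρ f x`, uniformly on a compact convex set. -/
lemma exists_taylor_bound_mul {f : E → ℝ} {U D : Set E} (hU : IsOpen U) (hf : ContDiffOn ℝ 1 f U)
    (hD : IsCompact D) (hconv : Convex ℝ D) (hDU : D ⊆ U) {R : ℝ} (hR : 0 ≤ R) {η : ℝ}
    (hη : 0 < η) :
    ∃ δ > 0, ∀ x ∈ D, ∀ y ∈ D, ∀ ρ ρ' d : ℝ, |ρ| ≤ R → |ρ' - ρ| ≤ d → ‖y - x‖ ≤ d → d < δ →
      |ρ' * f y - ρ * f x - ((ρ' - ρ) * f x + ρ * fderiv ℝ f x (y - x))| ≤ η * d := by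
  have hc : ContinuousOn (fderiv ℝ f) D := (hf.continuousOn_fderiv_of_isOpen hU le_rfl).mono hDU
  obtain ⟨M, hM⟩ := hD.exists_bound_of_continuousOn hc
  obtain ⟨δ, hδ, h⟩ := exists_taylor_bound hU hf hD hconv hDU
    (show 0 < η / (2 * (R + 1)) by positivity)
  -- The second bound absorbs the product `(ρ' - ρ) (f y - f x)`, which is quadratic in `d`.
  refine ⟨min δ (η / (2 * (|M| + η + 1))), by positivity, ?_⟩
  intro x hx y hy ρ ρ' d hρ hρ' hxy hd
  have hd0 : 0 ≤ d := (norm_nonneg _).trans hxy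
  have hηR : η / (2 * (R + 1)) ≤ η := div_le_self hη.le (by linarith)
  have h1 := h x hx y hy (hxy.trans_lt (hd.trans_le (min_le_left _ _)))
  have h2 : |f y - f x - fderiv ℝ f x (y - x)| ≤ η / (2 * (R + 1)) * d := h1.trans (by gcongr)
  have h3 : |fderiv ℝ f x (y - x)| ≤ |M| * d :=
    ((fderiv ℝ f x).le_opNorm _).trans (mul_le_mul ((hM x hx).trans (le_abs_self M)) hxy
      (norm_nonneg _) (abs_nonneg _))
  have h4 : |f y - f x| ≤ (|M| + η) * d := by
    have : f y - f x = (f y - f x - fderiv ℝ f x (y - x)) + fderiv ℝ f x (y - x) := by ring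
    rw [this]
    refine (abs_add_le _ _).trans ?_
    have := mul_le_mul_of_nonneg_right hηR hd0
    linarith
  have h5 : (|M| + η + 1) * d ≤ η / 2 := by
    have := (hd.trans_le (min_le_right _ _)).le
    rw [le_div_iff₀ (by positivity)] at this
    linarith
  have h6 : ρ' * f y - ρ * f x - ((ρ' - ρ) * f x + ρ * fderiv ℝ f x (y - x)) =
      ρ * (f y - f x - fderiv ℝ f x (y - x)) + (ρ' - ρ) * (f y - f x) := by ring
  rw [h6]
  have h7 : |ρ * (f y - f x - fderiv ℝ f x (y - x))| ≤ R * (η / (2 * (R + 1)) * d) := by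
    rw [abs_mul]
    exact mul_le_mul hρ h2 (abs_nonneg _) hR
  have h8 : |(ρ' - ρ) * (f y - f x)| ≤ d * ((|M| + η) * d) := by
    rw [abs_mul]
    exact mul_le_mul hρ' h4 (abs_nonneg _) hd0
  have h9 : R * (η / (2 * (R + 1)) * d) ≤ η / 2 * d := by
    have : R * (η / (2 * (R + 1)) * d) = (R / (R + 1)) * (η / 2 * d) := by field_simp
    rw [this]
    exact mul_le_of_le_one_left (by positivity) ((div_le_one (by positivity)).2 (by linarith))
  have h10 : d * ((|M| + η) * d) ≤ d * (η / 2) := by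
    refine mul_le_mul_of_nonneg_left ?_ hd0
    linarith
  refine (abs_add_le _ _).trans ?_
  linarith

end Taylor

lemma mk_eq_smul_one_add_smul_I (x y : ℝ) : (⟨x, y⟩ : ℂ) = x • (1 : ℂ) + y • Complex.I := by
  apply Complex.ext <;> simp

/-! ### A potential for the weighted area. -/

section Potential

open MeasureTheory intervalIntegral

/-- Differentiation under the integral sign: the derivative in `z` is bounded on the product of a
closed ball and `[0, 1]`, which is compact. -/
lemma contDiff_one_integral {F : ℂ × ℝ → ℝ} (hF : ContDiff ℝ 1 F) :
    ContDiff ℝ 1 fun z => ∫ t in (0 : ℝ)..1, F (z, t) := by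
  set F' : ℂ → ℝ → ℂ →L[ℝ] ℝ := fun z t =>
    (fderiv ℝ F (z, t)).comp (ContinuousLinearMap.inl ℝ ℂ ℝ) with hF'
  have hcF' : Continuous (Function.uncurry F') :=
    (hF.continuous_fderiv one_ne_zero).clm_comp continuous_const
  rw [contDiff_one_iff_hasFDerivAt]
  refine ⟨fun z => ∫ t in (0 : ℝ)..1, F' z t,
    continuous_parametric_intervalIntegral_of_continuous' hcF' 0 1, fun z => ?_⟩
  obtain ⟨M, hM⟩ := ((isCompact_closedBall z 1).prod (isCompact_Icc (a := (0 : ℝ)) (b := 1))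
    ).exists_bound_of_continuousOn hcF'.continuousOn
  refine hasFDerivAt_integral_of_dominated_of_fderiv_le'' (bound := fun _ => M)
    (Metric.closedBall_mem_nhds z one_pos) (Eventually.of_forall fun w => ?_) ?_ ?_ ?_ ?_ ?_
  · exact (hF.continuous.comp (by fun_prop : Continuous fun t : ℝ => (w, t))).aestronglyMeasurable
  · exact (hF.continuous.comp
      (by fun_prop : Continuous fun t : ℝ => (z, t))).intervalIntegrable _ _
  · exact (hcF'.comp (by fun_prop : Continuous fun t : ℝ => (z, t))).aestronglyMeasurable
  · refine (ae_restrict_iff' measurableSet_uIoc).2 (Eventually.of_forall fun t ht w hw => ?_)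
    rw [Set.uIoc_of_le zero_le_one] at ht
    exact hM (w, t) ⟨hw, Set.Ioc_subset_Icc_self ht⟩
  · exact intervalIntegrable_const
  · refine Eventually.of_forall fun t w _ => ?_
    exact ((hF.differentiable one_ne_zero (w, t)).hasFDerivAt).comp w
      (hasFDerivAt_prodMk_left w t)

/-- The potential `-∫₀^y g (x + i t) dt`. -/
noncomputable def vertPotential (g : ℂ → ℝ) (z : ℂ) : ℝ :=
  ∫ t in (0 : ℝ)..1, -(z.im * g (z.re + (z.im * t : ℝ) * Complex.I))

lemma contDiff_vertPotential {g : ℂ → ℝ} (hg : ContDiff ℝ 1 g) :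
    ContDiff ℝ 1 (vertPotential g) := by
  refine contDiff_one_integral
    (F := fun p : ℂ × ℝ => -(p.1.im * g (p.1.re + (p.1.im * p.2 : ℝ) * Complex.I))) ?_
  have hre : ContDiff ℝ 1 fun p : ℂ × ℝ => p.1.re := Complex.reCLM.contDiff.comp contDiff_fst
  have him : ContDiff ℝ 1 fun p : ℂ × ℝ => p.1.im := Complex.imCLM.contDiff.comp contDiff_fst
  refine (him.mul (hg.comp ?_)).neg
  exact (Complex.ofRealCLM.contDiff.comp hre).add
    ((Complex.ofRealCLM.contDiff.comp (him.mul contDiff_snd)).mul contDiff_const)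

/-- Only the vertical derivative has to be known: by Green's formula it is the area density, while
the horizontal one cancels in the first variation. -/
lemma fderiv_vertPotential_I {g : ℂ → ℝ} (hg : ContDiff ℝ 1 g) (z : ℂ) :
    fderiv ℝ (vertPotential g) z Complex.I = -g z := by
  have hline : HasDerivAt (fun y : ℝ => (z.re : ℂ) + y * Complex.I) Complex.I z.im := by
    simpa using ((Complex.ofRealCLM.hasDerivAt (x := z.im)).mul_const Complex.I).const_add (z.re : ℂ)
  have hz : (z.re : ℂ) + z.im * Complex.I = z := Complex.re_add_im z
  have h1 : HasDerivAt (fun y : ℝ => vertPotential g (z.re + y * Complex.I))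
      (fderiv ℝ (vertPotential g) z Complex.I) z.im := by
    have h := ((contDiff_vertPotential hg).differentiable one_ne_zero
      (z.re + z.im * Complex.I)).hasFDerivAt.comp_hasDerivAt z.im hline
    rwa [hz] at h
  have hgc : Continuous fun t : ℝ => g (z.re + t * Complex.I) := hg.continuous.comp (by fun_prop)
  have h2 : (fun y : ℝ => vertPotential g (z.re + y * Complex.I)) =
      fun y => -∫ t in (0 : ℝ)..y, g (z.re + t * Complex.I) := by
    ext y
    have h := smul_integral_comp_mul_left (a := 0) (b := 1)
      (fun t : ℝ => g (z.re + t * Complex.I)) y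
    simp only [mul_zero, mul_one, smul_eq_mul] at h
    simp only [vertPotential, Complex.add_re, Complex.ofReal_re, Complex.mul_re, Complex.I_re,
      mul_zero, Complex.ofReal_im, Complex.I_im, mul_one, sub_self, add_zero, Complex.add_im,
      Complex.mul_im, zero_add]
    rw [← h, intervalIntegral.integral_neg, intervalIntegral.integral_const_mul]
  rw [h2] at h1
  refine h1.unique ?_
  have h3 := (hgc.integral_hasStrictDerivAt 0 z.im).hasDerivAt.fun_neg
  rwa [hz] at h3

end Potential

/-! ### The reduced energy and its gradient. -/

section Energy

open Real MeasureTheory intervalIntegral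

/-- Length plus area weighted by `k + ε g (im)²`, for a closed curve in the upper half-plane. -/
noncomputable def curveEnergy (g : ℂ → ℝ) (k ε : ℝ) (r u v : ℝ → ℝ) : ℝ :=
  ∫ θ in (0 : ℝ)..2 * π, (r θ * (v θ)⁻¹ +
    sin θ * (r θ * (k * (v θ)⁻¹ + ε * vertPotential g ⟨u θ, v θ⟩)))

lemma hasFDerivAt_inv_im {z : ℂ} (hz : 0 < z.im) :
    HasFDerivAt (fun w : ℂ => (w.im)⁻¹) (-(z.im ^ 2)⁻¹ • Complex.imCLM) z :=
  (hasDerivAt_inv hz.ne').comp_hasFDerivAt z Complex.imCLM.hasFDerivAt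

lemma contDiffOn_inv_im : ContDiffOn ℝ 1 (fun w : ℂ => (w.im)⁻¹) HypPlane :=
  Complex.imCLM.contDiff.contDiffOn.inv fun _ hw => (ne_of_gt hw)

lemma isOpen_hypPlane : IsOpen HypPlane := isOpen_lt continuous_const Complex.continuous_im

/-- Derivative of the energy along a family of closed curves that are critical up to a
multiplier and have prescribed mean. -/
theorem hasFDerivAt_curveEnergy {g : ℂ → ℝ} (hg : ContDiff ℝ 1 g) {k ε : ℝ} {D Z : Set ℂ}
    (hD : IsCompact D) (hconv : Convex ℝ D) (hDH : D ⊆ HypPlane) (hZ : IsOpen Z)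
    {r u v : ℂ → ℝ → ℝ} {a b : ℂ → ℝ} {C : ℝ} (hC : 0 ≤ C)
    (hcurve : ∀ z ∈ Z, IsAngleCurve (r z) (u z) (v z))
    (hmem : ∀ z ∈ Z, ∀ θ, (⟨u z θ, v z θ⟩ : ℂ) ∈ D)
    (hmean_fst : ∀ z ∈ Z, ∫ θ in (0 : ℝ)..2 * π, u z θ = 2 * π * z.re)
    (hmean_snd : ∀ z ∈ Z, ∫ θ in (0 : ℝ)..2 * π, v z θ = 2 * π * z.im)
    (hbound : ∀ z ∈ Z, ∀ θ, |r z θ| ≤ C)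
    (hlip_r : ∀ z ∈ Z, ∀ w ∈ Z, ∀ θ, |r w θ - r z θ| ≤ C * ‖w - z‖)
    (hlip : ∀ z ∈ Z, ∀ w ∈ Z, ∀ θ, ‖(⟨u w θ, v w θ⟩ - ⟨u z θ, v z θ⟩ : ℂ)‖ ≤ C * ‖w - z‖)
    (heq : ∀ z ∈ Z, ∀ θ, v z θ - (a z * cos θ + b z * sin θ) * v z θ ^ 2 =
      r z θ * (k + ε * (g ⟨u z θ, v z θ⟩ * v z θ ^ 2) + sin θ)) {z : ℂ} (hz : z ∈ Z) :
    HasFDerivAt (fun w => curveEnergy g k ε (r w) (u w) (v w))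
      ((π * a z) • Complex.reCLM + (π * b z) • Complex.imCLM) z := by
  have hq := contDiff_vertPotential hg
  have hv : ∀ w ∈ Z, ∀ θ, 0 < v w θ := fun w hw θ => hDH (hmem w hw θ)
  have hA := contDiffOn_inv_im
  have hB : ContDiffOn ℝ 1 (fun w : ℂ => k * (w.im)⁻¹ + ε * vertPotential g w) HypPlane :=
    (contDiffOn_const.mul hA).add (contDiffOn_const.mul hq.contDiffOn)
  have hcq : ∀ w ∈ Z, Continuous fun θ => vertPotential g ⟨u w θ, v w θ⟩ := fun w hw => by
    have h1 := (hcurve w hw).continuous_fst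
    have h2 := (hcurve w hw).continuous_snd
    refine hq.continuous.comp ?_
    simp only [Complex.mk_eq_add_mul_I]
    fun_prop
  have hint : ∀ w ∈ Z, Continuous fun θ => (r w θ * (v w θ)⁻¹ +
      sin θ * (r w θ * (k * (v w θ)⁻¹ + ε * vertPotential g ⟨u w θ, v w θ⟩))) := fun w hw => by
    have h1 := (hcurve w hw).continuous_speed
    have h2 := (hcurve w hw).continuous_snd
    have h3 := hcq w hw
    have h4 : ∀ θ, v w θ ≠ 0 := fun θ => (hv w hw θ).ne'
    fun_prop (disch := assumption)
  rw [hasFDerivAt_iff_isLittleO, Asymptotics.isLittleO_iff]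
  intro c hc
  -- Two Taylor errors of size `η C ‖w - z‖`, integrated over a period, must stay below `c ‖w - z‖`;
  -- `C + 1` replaces `C` in the denominator because `C` may be zero.
  have hη : 0 < c / (2 * (C + 1) * (2 * π)) := by have := pi_pos; positivity
  obtain ⟨δ₁, hδ₁, h₁⟩ := exists_taylor_bound_mul isOpen_hypPlane hA hD hconv hDH hC hη
  obtain ⟨δ₂, hδ₂, h₂⟩ := exists_taylor_bound_mul isOpen_hypPlane hB hD hconv hDH hC hη
  have hδ : 0 < min δ₁ δ₂ / (C + 1) := by positivity
  filter_upwards [hZ.mem_nhds hz, Metric.ball_mem_nhds z hδ] with w hw hwδ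
  rw [Metric.mem_ball, dist_eq_norm, lt_div_iff₀ (by positivity)] at hwδ
  have hd : C * ‖w - z‖ < min δ₁ δ₂ := by
    have := norm_nonneg (w - z)
    linarith
  set γ : ℝ → ℝ := fun θ => g ⟨u z θ, v z θ⟩
  set qx : ℝ → ℝ := fun θ => fderiv ℝ (vertPotential g) ⟨u z θ, v z θ⟩ 1
  have hz' := hcurve z hz
  have hcz : Continuous fun θ => (⟨u z θ, v z θ⟩ : ℂ) := by
    have h1 := hz'.continuous_fst
    have h2 := hz'.continuous_snd
    simp only [Complex.mk_eq_add_mul_I]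
    fun_prop
  have hγ : Continuous γ := hg.continuous.comp hcz
  have hqx : Continuous qx :=
    ((hq.continuous_fderiv one_ne_zero).comp hcz).clm_apply continuous_const
  have hfq : ∀ p : ℂ, ∀ x y : ℝ, fderiv ℝ (vertPotential g) p ⟨x, y⟩ =
      fderiv ℝ (vertPotential g) p 1 * x - g p * y := fun p x y => by
    rw [mk_eq_smul_one_add_smul_I, map_add, map_smul, map_smul, fderiv_vertPotential_I hg]
    simp only [smul_eq_mul]
    ring
  have hdq : ∀ θ, HasDerivAt (fun θ => vertPotential g ⟨u z θ, v z θ⟩)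
      (-(qx θ * (r z θ * sin θ)) - γ θ * (r z θ * cos θ)) θ := fun θ => by
    have hc' : HasDerivAt (fun θ => (⟨u z θ, v z θ⟩ : ℂ))
        ⟨-(r z θ * sin θ), r z θ * cos θ⟩ θ := by
      have h := (hz'.hasDerivAt_fst θ).ofReal_comp.add
        ((hz'.hasDerivAt_snd θ).ofReal_comp.mul_const Complex.I)
      simp only [Complex.mk_eq_add_mul_I]
      exact h
    refine ((hq.differentiable one_ne_zero _).hasFDerivAt.comp_hasDerivAt θ hc').congr_deriv ?_
    rw [hfq]
    ring
  -- The variation is the actual difference of the curves of centres `w` and `z`, so the linear term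
  -- depends on `w - z` alone.
  have hvar := hz'.integral_first_variation (hv z hz) hγ (heq z hz) hqx hdq
    (by simp only [hz'.fst_closed, hz'.snd_closed]) (hz'.sub (hcurve w hw))
  have hmean : ∫ θ in (0 : ℝ)..2 * π, (u w θ - u z θ) = 2 * π * (w - z).re := by
    rw [integral_sub ((hcurve w hw).continuous_fst.intervalIntegrable _ _)
      (hz'.continuous_fst.intervalIntegrable _ _), hmean_fst w hw, hmean_fst z hz, Complex.sub_re]
    ring
  have hmean' : ∫ θ in (0 : ℝ)..2 * π, (v w θ - v z θ) = 2 * π * (w - z).im := by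
    rw [integral_sub ((hcurve w hw).continuous_snd.intervalIntegrable _ _)
      (hz'.continuous_snd.intervalIntegrable _ _), hmean_snd w hw, hmean_snd z hz, Complex.sub_im]
    ring
  rw [hmean, hmean'] at hvar
  have hlin : ((π * a z) • Complex.reCLM + (π * b z) • Complex.imCLM : ℂ →L[ℝ] ℝ) (w - z) =
      a z * (2 * π * (w - z).re) / 2 + b z * (2 * π * (w - z).im) / 2 := by
    simp only [_root_.add_apply, _root_.smul_apply, Complex.reCLM_apply, Complex.imCLM_apply,
      smul_eq_mul]
    ring
  have hcontlin : Continuous fun θ => ((r w θ - r z θ) / v z θ -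
      r z θ * (v w θ - v z θ) / v z θ ^ 2 + sin θ * ((r w θ - r z θ) * (k / v z θ +
      ε * vertPotential g ⟨u z θ, v z θ⟩) + r z θ * (-(k * (v w θ - v z θ) / v z θ ^ 2) +
      ε * (qx θ * (u w θ - u z θ) - γ θ * (v w θ - v z θ))))) := by
    have h1 := (hcurve w hw).continuous_speed
    have h2 := (hcurve w hw).continuous_fst
    have h3 := (hcurve w hw).continuous_snd
    have h4 := hz'.continuous_speed
    have h5 := hz'.continuous_fst
    have h6 := hz'.continuous_snd
    have h7 := hcq z hz
    have h8 : ∀ θ, v z θ ≠ 0 := fun θ => (hv z hz θ).ne'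
    have h9 : ∀ θ, v z θ ^ 2 ≠ 0 := fun θ => pow_ne_zero 2 (h8 θ)
    fun_prop (disch := assumption)
  rw [hlin, ← hvar, curveEnergy, curveEnergy, ← integral_sub ((hint w hw).intervalIntegrable _ _)
    ((hint z hz).intervalIntegrable _ _),
    ← integral_sub (((hint w hw).fun_sub (hint z hz)).intervalIntegrable _ _)
      (hcontlin.intervalIntegrable _ _)]
  have hpt : ∀ θ ∈ Set.uIoc (0 : ℝ) (2 * π), ‖r w θ * (v w θ)⁻¹ +
      sin θ * (r w θ * (k * (v w θ)⁻¹ + ε * vertPotential g ⟨u w θ, v w θ⟩)) -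
      (r z θ * (v z θ)⁻¹ +
      sin θ * (r z θ * (k * (v z θ)⁻¹ + ε * vertPotential g ⟨u z θ, v z θ⟩))) -
      ((r w θ - r z θ) / v z θ -
      r z θ * (v w θ - v z θ) / v z θ ^ 2 + sin θ * ((r w θ - r z θ) * (k / v z θ +
      ε * vertPotential g ⟨u z θ, v z θ⟩) + r z θ * (-(k * (v w θ - v z θ) / v z θ ^ 2) +
      ε * (qx θ * (u w θ - u z θ) - γ θ * (v w θ - v z θ)))))‖ ≤
      2 * (c / (2 * (C + 1) * (2 * π)) * (C * ‖w - z‖)) := by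
    intro θ _
    have e₁ := h₁ _ (hmem z hz θ) _ (hmem w hw θ) (r z θ) (r w θ) (C * ‖w - z‖) (hbound z hz θ)
      (hlip_r z hz w hw θ) (hlip z hz w hw θ) (hd.trans_le (min_le_left _ _))
    have e₂ := h₂ _ (hmem z hz θ) _ (hmem w hw θ) (r z θ) (r w θ) (C * ‖w - z‖) (hbound z hz θ)
      (hlip_r z hz w hw θ) (hlip z hz w hw θ) (hd.trans_le (min_le_right _ _))
    have hA' := hasFDerivAt_inv_im (z := ⟨u z θ, v z θ⟩) (hv z hz θ)
    have hB' : HasFDerivAt (fun w : ℂ => k * (w.im)⁻¹ + ε * vertPotential g w) _ _ :=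
      (hA'.const_mul k).add ((hq.differentiable one_ne_zero ⟨u z θ, v z θ⟩).hasFDerivAt.const_mul ε)
    rw [hA'.fderiv] at e₁
    rw [hB'.fderiv] at e₂
    have hsub : (⟨u w θ, v w θ⟩ - ⟨u z θ, v z θ⟩ : ℂ) = ⟨u w θ - u z θ, v w θ - v z θ⟩ := rfl
    rw [hsub] at e₁ e₂
    simp only [_root_.add_apply, _root_.smul_apply, Complex.imCLM_apply, smul_eq_mul] at e₁ e₂
    rw [hfq] at e₂
    have hs : |sin θ| ≤ 1 := abs_sin_le_one θ
    have e₃ := (abs_mul (sin θ) _).trans_le ((mul_le_of_le_one_left (abs_nonneg _) hs).trans e₂)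
    refine le_trans (le_of_eq ?_) ((abs_add_le _ _).trans (add_le_add e₁ e₃) |>.trans_eq
      (two_mul _).symm)
    rw [Real.norm_eq_abs]
    congr 1
    simp only [div_eq_mul_inv]
    ring
  refine (norm_integral_le_of_norm_le_const hpt).trans ?_
  have hπ := pi_pos
  rw [sub_zero, abs_of_pos two_pi_pos]
  have : 2 * (c / (2 * (C + 1) * (2 * π)) * (C * ‖w - z‖)) * (2 * π) =
      C / (C + 1) * (c * ‖w - z‖) := by
    field_simp
  rw [this]
  exact mul_le_of_le_one_left (by positivity) ((div_le_one (by positivity)).2 (by linarith))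

end Energy

/-! ### Asymptotics of the multiplier as the radius tends to zero. -/

section MultiplierAsymptotics

open Real MeasureTheory intervalIntegral

/-- At a point `c ≈ z + s z₂ e` with speed `ρ ≈ s z₂`, the increment of `K` is about `s z₂ ∂ₑK(z)`;
multiplying by `ρ / c₂² ≈ s / z₂` cancels the powers of `z₂`. -/
lemma exists_flux_density_bound {K : ℂ → ℝ} (hK : ContDiff ℝ 1 K) {B y₀ C η : ℝ} (hB : 0 ≤ B)
    (hy₀ : 0 < y₀) (hC : 0 ≤ C) (hη : 0 < η) :
    ∃ s₁ > 0, ∀ s, 0 < s → s < s₁ → ∀ z c e : ℂ, ∀ ρ : ℝ, ‖z‖ ≤ B → 0 ≤ z.im → ‖e‖ ≤ 1 →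
      |ρ - s * z.im| ≤ C * s ^ 2 → ‖c - z - (s * z.im) • e‖ ≤ C * s ^ 2 → y₀ ≤ c.im →
      |(K c - K z) * ρ / c.im ^ 2 - s ^ 2 * fderiv ℝ K z e| ≤ η * s ^ 2 := by
  obtain ⟨M, hM⟩ := (isCompact_closedBall (0 : ℂ) B).exists_bound_of_continuousOn
    (hK.continuous_fderiv one_ne_zero).continuousOn
  have hM0 : 0 ≤ M := (norm_nonneg _).trans (hM 0 (Metric.mem_closedBall_self hB))
  set T := B + C with hT
  have hT0 : 0 ≤ T := by positivity
  obtain ⟨δ, hδ, h⟩ := exists_taylor_bound isOpen_univ hK.contDiffOn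
    (isCompact_closedBall (0 : ℂ) (B + T)) (convex_closedBall _ _) (Set.subset_univ _)
    (show 0 < η * y₀ ^ 2 / (2 * (T + 1) ^ 2) by positivity)
  -- The coefficient of the `s³` errors, from the displacement `c - z - s z₂ e`, from `ρ - s z₂`,
  -- and from replacing `c₂²` by `z₂²`.
  set N := M * C * T + B * M * C + M * T * (2 * B + T) with hN
  have hN0 : 0 ≤ N := by positivity
  refine ⟨min (min 1 (δ / (T + 1))) (η * y₀ ^ 2 / (2 * (N + 1))), by positivity, ?_⟩
  intro s hs hs₁ z c e ρ hz hzim he hρ hc hcim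
  have hs1 : s ≤ 1 := (hs₁.trans_le ((min_le_left _ _).trans (min_le_left _ _))).le
  have hsδ : s * (T + 1) < δ := by
    have := hs₁.trans_le ((min_le_left _ _).trans (min_le_right _ _))
    rwa [lt_div_iff₀ (by positivity)] at this
  have hsN : s * (2 * (N + 1)) ≤ η * y₀ ^ 2 := by
    have := (hs₁.trans_le (min_le_right _ _)).le
    rwa [le_div_iff₀ (by positivity)] at this
  have hzB : z.im ≤ B := (le_abs_self _).trans ((Complex.abs_im_le_norm z).trans hz)
  have hss : s ^ 2 ≤ s := by nlinarith
  have hCs : C * s ^ 2 ≤ C * s := by gcongr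
  have hd : ‖(s * z.im) • e‖ ≤ s * B := by
    rw [norm_smul, Real.norm_of_nonneg (by positivity)]
    calc s * z.im * ‖e‖ ≤ s * B * 1 := by gcongr
      _ = s * B := mul_one _
  have hcz : ‖c - z‖ ≤ s * T := by
    have : c - z = (c - z - (s * z.im) • e) + (s * z.im) • e := by abel
    rw [this]
    refine (norm_add_le _ _).trans ?_
    rw [hT]
    linarith
  have hsT : s * T ≤ T := mul_le_of_le_one_left hT0 hs1
  have hcB : ‖c‖ ≤ B + T := by
    have : c = z + (c - z) := by abel
    rw [this]
    exact (norm_add_le _ _).trans (add_le_add hz (hcz.trans hsT))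
  have htay := h z (mem_closedBall_zero_iff.2 (by linarith)) c (mem_closedBall_zero_iff.2 hcB)
    (hcz.trans_lt (by linarith))
  have hMz : ‖fderiv ℝ K z‖ ≤ M := hM z (mem_closedBall_zero_iff.2 hz)
  set d := fderiv ℝ K z e with hd'
  have hdM : |d| ≤ M := ((fderiv ℝ K z).le_opNorm e).trans
    ((mul_le_mul hMz he (norm_nonneg _) hM0).trans_eq (mul_one M))
  have hlin : |fderiv ℝ K z (c - z) - s * z.im * d| ≤ M * (C * s ^ 2) := by
    have : fderiv ℝ K z (c - z) - s * z.im * d = fderiv ℝ K z (c - z - (s * z.im) • e) := by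
      rw [map_sub (fderiv ℝ K z) (c - z), map_smul, smul_eq_mul]
    rw [this]
    exact ((fderiv ℝ K z).le_opNorm _).trans (mul_le_mul hMz hc (norm_nonneg _) hM0)
  have hP : |(K c - K z) - s * z.im * d| ≤
      η * y₀ ^ 2 / (2 * (T + 1) ^ 2) * (s * T) + M * (C * s ^ 2) := by
    have : (K c - K z) - s * z.im * d =
      (K c - K z - fderiv ℝ K z (c - z)) + (fderiv ℝ K z (c - z) - s * z.im * d) := by ring
    rw [this]
    exact (abs_add_le _ _).trans (add_le_add (htay.trans (by gcongr)) hlin)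
  have hρT : |ρ| ≤ s * T := by
    have : ρ = (ρ - s * z.im) + s * z.im := by ring
    rw [this]
    refine (abs_add_le _ _).trans ?_
    rw [abs_of_nonneg (show 0 ≤ s * z.im by positivity), hT]
    have := mul_le_mul_of_nonneg_left hzB hs.le
    linarith
  have hvT : |z.im - c.im| ≤ s * T := by
    rw [abs_sub_comm]
    simpa using (Complex.abs_im_le_norm (c - z)).trans hcz
  have hvB : |z.im + c.im| ≤ 2 * B + T := by
    have : z.im + c.im = 2 * z.im + (c.im - z.im) := by ring
    rw [this]
    refine (abs_add_le _ _).trans ?_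
    rw [abs_sub_comm, abs_of_nonneg (show 0 ≤ 2 * z.im by positivity)]
    linarith
  have hc0 : 0 < c.im := hy₀.trans_le hcim
  have e1 : (K c - K z) * ρ / c.im ^ 2 - s ^ 2 * d =
      (((K c - K z) - s * z.im * d) * ρ + s * z.im * d * (ρ - s * z.im) +
        s ^ 2 * d * ((z.im - c.im) * (z.im + c.im))) / c.im ^ 2 := by
    field_simp
    ring
  have b1 : |((K c - K z) - s * z.im * d) * ρ| ≤
      (η * y₀ ^ 2 / (2 * (T + 1) ^ 2) * (s * T) + M * (C * s ^ 2)) * (s * T) := by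
    rw [abs_mul]
    exact mul_le_mul hP hρT (abs_nonneg _) (by positivity)
  have b2 : |s * z.im * d * (ρ - s * z.im)| ≤ s * B * M * (C * s ^ 2) := by
    rw [abs_mul, abs_mul, abs_of_nonneg (show 0 ≤ s * z.im by positivity)]
    gcongr
  have b3 : |s ^ 2 * d * ((z.im - c.im) * (z.im + c.im))| ≤
      s ^ 2 * M * ((s * T) * (2 * B + T)) := by
    rw [abs_mul, abs_mul, abs_mul, abs_of_nonneg (show 0 ≤ s ^ 2 by positivity)]
    gcongr
  have b4 : η * y₀ ^ 2 / (2 * (T + 1) ^ 2) * (s * T) * (s * T) ≤ η * y₀ ^ 2 / 2 * s ^ 2 := by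
    have : η * y₀ ^ 2 / (2 * (T + 1) ^ 2) * (s * T) * (s * T) =
      (T / (T + 1)) ^ 2 * (η * y₀ ^ 2 / 2 * s ^ 2) := by field_simp
    rw [this]
    refine mul_le_of_le_one_left (by positivity) (pow_le_one₀ (by positivity) ?_)
    exact (div_le_one (by positivity)).2 (by linarith)
  rw [e1, abs_div, abs_of_pos (show 0 < c.im ^ 2 by positivity), div_le_iff₀ (by positivity)]
  have b5 : η * s ^ 2 * y₀ ^ 2 ≤ η * s ^ 2 * c.im ^ 2 := by gcongr
  have b6 : s * N * s ^ 2 ≤ η * y₀ ^ 2 / 2 * s ^ 2 := by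
    refine mul_le_mul_of_nonneg_right ?_ (by positivity)
    linarith
  refine ((abs_add_le _ _).trans (add_le_add (abs_add_le _ _) le_rfl)).trans ?_
  have b7 : M * (C * s ^ 2) * (s * T) + s * B * M * (C * s ^ 2) +
      s ^ 2 * M * ((s * T) * (2 * B + T)) = s * N * s ^ 2 := by rw [hN]; ring
  linarith

lemma abs_integral_sub_le {f h : ℝ → ℝ} (hf : Continuous f) (hh : Continuous h) {c : ℝ}
    (hfh : ∀ θ, |f θ - h θ| ≤ c) :
    |(∫ θ in (0 : ℝ)..2 * π, f θ) - ∫ θ in (0 : ℝ)..2 * π, h θ| ≤ c * (2 * π) := by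
  rw [← integral_sub (hf.intervalIntegrable _ _) (hh.intervalIntegrable _ _)]
  have h1 := norm_integral_le_of_norm_le_const (a := 0) (b := 2 * π) (f := fun θ => f θ - h θ)
    (C := c) fun θ _ => hfh θ
  rwa [sub_zero, abs_of_pos two_pi_pos] at h1

lemma integral_trig_mul_trig (a b x y : ℝ) :
    ∫ θ in (0 : ℝ)..2 * π, (a * cos θ + b * sin θ) * (x * cos θ + y * sin θ) =
      π * (a * x + b * y) := by
  have : ∀ θ, (a * cos θ + b * sin θ) * (x * cos θ + y * sin θ) =
      (a * x) * cos θ ^ 2 + ((a * y + b * x) * (sin θ * cos θ) + (b * y) * sin θ ^ 2) :=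
    fun θ => by ring
  simp only [this]
  rw [integral_add (Continuous.intervalIntegrable (by fun_prop) _ _)
    (Continuous.intervalIntegrable (by fun_prop) _ _),
    integral_add (Continuous.intervalIntegrable (by fun_prop) _ _)
    (Continuous.intervalIntegrable (by fun_prop) _ _), intervalIntegral.integral_const_mul,
    intervalIntegral.integral_const_mul, intervalIntegral.integral_const_mul, integral_cos_sq,
    integral_sin_mul_cos₁, integral_sin_sq]
  simp
  ring

/-- The multiplier of an almost circular curve of radius `s z₂` with mean `z` is
`-ε s² ∇K(z)`, up to an error of lower order. -/
lemma exists_multiplier_bound {g : ℂ → ℝ} (hg : ContDiff ℝ 1 g) {K : ℂ → ℝ}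
    (hK : ∀ z, K z = g z * z.im ^ 2) {B y₀ C η : ℝ} (hB : 0 ≤ B) (hy₀ : 0 < y₀) (hC : 0 ≤ C)
    (hη : 0 < η) :
    ∃ s₁ > 0, ∀ s, 0 < s → s < s₁ → ∀ (ε k a b : ℝ) (z : ℂ) (r u v : ℝ → ℝ), ‖z‖ ≤ B → y₀ ≤ z.im →
      IsAngleCurve r u v → ∫ θ in (0 : ℝ)..2 * π, u θ = 2 * π * z.re →
      ∫ θ in (0 : ℝ)..2 * π, v θ = 2 * π * z.im → (∀ θ, y₀ ≤ v θ) →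
      (∀ θ, |r θ - s * z.im| ≤ C * s ^ 2) →
      (∀ θ, ‖(⟨u θ, v θ⟩ : ℂ) - z - (s * z.im) • (⟨cos θ, sin θ⟩ : ℂ)‖ ≤ C * s ^ 2) →
      (∀ θ, v θ - (a * cos θ + b * sin θ) * v θ ^ 2 =
        r θ * (k + ε * (g ⟨u θ, v θ⟩ * v θ ^ 2) + sin θ)) →
      |a + ε * s ^ 2 * fderiv ℝ K z 1| ≤ |ε| * s ^ 2 * η ∧
      |b + ε * s ^ 2 * fderiv ℝ K z Complex.I| ≤ |ε| * s ^ 2 * η := by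
  have hKd : ContDiff ℝ 1 K := by
    rw [funext hK]
    exact hg.mul (Complex.imCLM.contDiff.pow 2)
  obtain ⟨M, hM⟩ := (isCompact_closedBall (0 : ℂ) B).exists_bound_of_continuousOn
    (hKd.continuous_fderiv one_ne_zero).continuousOn
  have hM0 : 0 ≤ M := (norm_nonneg _).trans (hM 0 (Metric.mem_closedBall_self hB))
  set T := B + C with hT
  have hT0 : 0 ≤ T := by positivity
  -- The first bound serves `a`. The second serves `b`, which is recovered from the dilation
  -- identity after division by `z₂ ≥ y₀`.
  set η' := min (η / 2) (η * y₀ / (8 * (2 * B + T + 1))) with hη'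
  have hη'0 : 0 < η' := by positivity
  obtain ⟨s₁, hs₁, h⟩ := exists_flux_density_bound hKd hB hy₀ hC hη'0
  refine ⟨min (min 1 s₁) (η * y₀ / (8 * (M * T + 1))), by positivity, ?_⟩
  intro s hs hss ε k a b z r u v hz hzim hcurve hu hv hvy hr hc heq
  have hs1 : s ≤ 1 := (hss.trans_le ((min_le_left _ _).trans (min_le_left _ _))).le
  have hss₁ : s < s₁ := hss.trans_le ((min_le_left _ _).trans (min_le_right _ _))
  have hsM : s * (8 * (M * T + 1)) ≤ η * y₀ := by
    have := (hss.trans_le (min_le_right _ _)).le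
    rwa [le_div_iff₀ (by positivity)] at this
  have hπ := pi_pos
  have hv0 : ∀ θ, 0 < v θ := fun θ => hy₀.trans_le (hvy θ)
  have hz0 : 0 < z.im := hy₀.trans_le hzim
  have hrc := hcurve.continuous_speed
  have huc := hcurve.continuous_fst
  have hvc := hcurve.continuous_snd
  have hcc : Continuous fun θ => (⟨u θ, v θ⟩ : ℂ) := by
    simp only [Complex.mk_eq_add_mul_I]
    fun_prop
  have hγ : Continuous fun θ => g ⟨u θ, v θ⟩ := hg.continuous.comp hcc
  have hKc : Continuous fun θ => K ⟨u θ, v θ⟩ := hKd.continuous.comp hcc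
  have hv2 : ∀ θ, v θ ^ 2 ≠ 0 := fun θ => pow_ne_zero 2 (hv0 θ).ne'
  set W : ℝ → ℝ := fun θ => (K ⟨u θ, v θ⟩ - K z) * r θ / v θ ^ 2 with hW
  have hWc : Continuous W := by fun_prop (disch := assumption)
  set kx := fderiv ℝ K z 1
  set ky := fderiv ℝ K z Complex.I
  have hfd : ∀ θ, fderiv ℝ K z (⟨cos θ, sin θ⟩ : ℂ) = kx * cos θ + ky * sin θ := fun θ => by
    rw [mk_eq_smul_one_add_smul_I, map_add, map_smul, map_smul, smul_eq_mul, smul_eq_mul]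
    ring
  have hnorm : ∀ θ, ‖(⟨cos θ, sin θ⟩ : ℂ)‖ ≤ 1 := fun θ => by
    rw [Complex.norm_def, Complex.normSq_mk, ← sq, ← sq, cos_sq_add_sin_sq, Real.sqrt_one]
  have hWb : ∀ θ, |W θ - s ^ 2 * (kx * cos θ + ky * sin θ)| ≤ η' * s ^ 2 := fun θ => by
    rw [← hfd]
    exact h s hs hss₁ z ⟨u θ, v θ⟩ ⟨cos θ, sin θ⟩ (r θ) hz hz0.le (hnorm θ) (hr θ) (hc θ) (hvy θ)
  -- On the curve `g = K / v²`; the constant `K z` contributes a multiple of an area flux that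
  -- vanishes.
  have hflux : ∀ w : ℝ → ℝ, Continuous w → ∫ θ in (0 : ℝ)..2 * π, r θ * w θ / v θ ^ 2 = 0 →
      ∫ θ in (0 : ℝ)..2 * π, g ⟨u θ, v θ⟩ * (r θ * w θ) = ∫ θ in (0 : ℝ)..2 * π, W θ * w θ := by
    intro w hw h0
    have h1 : ∀ θ, W θ * w θ = g ⟨u θ, v θ⟩ * (r θ * w θ) - K z * (r θ * w θ / v θ ^ 2) :=
      fun θ => by
        have := (hv0 θ).ne'
        simp only [hW, hK ⟨u θ, v θ⟩]
        field_simp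
    simp only [h1]
    rw [integral_sub (Continuous.intervalIntegrable (by fun_prop) _ _)
      (Continuous.intervalIntegrable (by fun_prop (disch := assumption)) _ _),
      intervalIntegral.integral_const_mul, h0, mul_zero, sub_zero]
  have ha := hcurve.integral_multiplier_translation hv0 hγ heq
  have hb := hcurve.integral_multiplier_dilation hv0 hγ heq
  rw [hflux _ continuous_cos (hcurve.integral_flux_translation hv0)] at ha
  rw [hflux _ (by fun_prop) (hcurve.integral_flux_dilation hv0), hu, hv] at hb
  have hdM : ∀ θ, |kx * cos θ + ky * sin θ| ≤ M := fun θ => by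
    rw [← hfd]
    exact ((fderiv ℝ K z).le_opNorm _).trans ((mul_le_mul
      (hM z (mem_closedBall_zero_iff.2 hz)) (hnorm θ) (norm_nonneg _) hM0).trans_eq (mul_one M))
  have hcz : ∀ θ, ‖(⟨u θ, v θ⟩ : ℂ) - z‖ ≤ s * T := fun θ => by
    have e : (⟨u θ, v θ⟩ : ℂ) - z = ((⟨u θ, v θ⟩ : ℂ) - z - (s * z.im) • (⟨cos θ, sin θ⟩ : ℂ)) +
      (s * z.im) • (⟨cos θ, sin θ⟩ : ℂ) := by abel
    rw [e]
    refine (norm_add_le _ _).trans ?_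
    have hzB : z.im ≤ B := (le_abs_self _).trans ((Complex.abs_im_le_norm z).trans hz)
    have e2 : ‖(s * z.im) • (⟨cos θ, sin θ⟩ : ℂ)‖ ≤ s * B := by
      rw [norm_smul, Real.norm_of_nonneg (by positivity)]
      calc s * z.im * ‖(⟨cos θ, sin θ⟩ : ℂ)‖ ≤ s * B * 1 := by gcongr; exact hnorm θ
        _ = s * B := mul_one _
    have e3 : C * s ^ 2 ≤ C * s := by
      gcongr
      nlinarith
    have e4 := hc θ
    rw [hT]
    linarith
  have hu' : ∀ θ, |u θ - z.re| ≤ s * T := fun θ => by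
    simpa using (Complex.abs_re_le_norm _).trans (hcz θ)
  have hv' : ∀ θ, |v θ - z.im| ≤ s * T := fun θ => by
    simpa using (Complex.abs_im_le_norm _).trans (hcz θ)
  have hre : |z.re| ≤ B := (Complex.abs_re_le_norm z).trans hz
  have him : |z.im| ≤ B := (Complex.abs_im_le_norm z).trans hz
  have htrig : ∀ x y c θ : ℝ, |x| ≤ c → |y| ≤ c → |x * cos θ + y * sin θ| ≤ 2 * c := by
    intro x y c θ hx hy
    refine (abs_add_le _ _).trans ?_
    rw [abs_mul, abs_mul]
    have h1 := mul_le_of_le_one_right (abs_nonneg x) (abs_cos_le_one θ)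
    have h2 := mul_le_of_le_one_right (abs_nonneg y) (abs_sin_le_one θ)
    linarith
  have hpd : ∀ θ, |(u θ * cos θ + v θ * sin θ) - (z.re * cos θ + z.im * sin θ)| ≤ 2 * (s * T) :=
    fun θ => by
      have := htrig _ _ _ θ (hu' θ) (hv' θ)
      convert this using 2
      ring
  have hzp : ∀ θ, |z.re * cos θ + z.im * sin θ| ≤ 2 * B := fun θ => htrig _ _ _ θ hre him
  have I1 : |(∫ θ in (0 : ℝ)..2 * π, W θ * cos θ) - s ^ 2 * (π * kx)| ≤
      η' * s ^ 2 * (2 * π) := by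
    have e : s ^ 2 * (π * kx) =
        ∫ θ in (0 : ℝ)..2 * π, s ^ 2 * ((kx * cos θ + ky * sin θ) * (1 * cos θ + 0 * sin θ)) := by
      rw [intervalIntegral.integral_const_mul, integral_trig_mul_trig]
      ring
    rw [e]
    refine abs_integral_sub_le (by fun_prop) (by fun_prop) fun θ => ?_
    have e1 : W θ * cos θ - s ^ 2 * ((kx * cos θ + ky * sin θ) * (1 * cos θ + 0 * sin θ)) =
      (W θ - s ^ 2 * (kx * cos θ + ky * sin θ)) * cos θ := by ring
    rw [e1, abs_mul]
    exact (mul_le_of_le_one_right (abs_nonneg _) (abs_cos_le_one θ)).trans (hWb θ)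
  have I2 : |(∫ θ in (0 : ℝ)..2 * π, W θ * (u θ * cos θ + v θ * sin θ)) -
      s ^ 2 * (π * (kx * z.re + ky * z.im))| ≤
      (η' * s ^ 2 * (2 * (B + T)) + s ^ 2 * M * (2 * (s * T))) * (2 * π) := by
    rw [← integral_trig_mul_trig, ← intervalIntegral.integral_const_mul]
    refine abs_integral_sub_le (by fun_prop) (by fun_prop) fun θ => ?_
    have e1 : W θ * (u θ * cos θ + v θ * sin θ) -
        s ^ 2 * ((kx * cos θ + ky * sin θ) * (z.re * cos θ + z.im * sin θ)) =
      (W θ - s ^ 2 * (kx * cos θ + ky * sin θ)) * (u θ * cos θ + v θ * sin θ) +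
      s ^ 2 * (kx * cos θ + ky * sin θ) *
        ((u θ * cos θ + v θ * sin θ) - (z.re * cos θ + z.im * sin θ)) := by ring
    have e2 : |u θ * cos θ + v θ * sin θ| ≤ 2 * (B + T) := by
      have : u θ * cos θ + v θ * sin θ = ((u θ * cos θ + v θ * sin θ) -
        (z.re * cos θ + z.im * sin θ)) + (z.re * cos θ + z.im * sin θ) := by ring
      rw [this]
      refine (abs_add_le _ _).trans ?_
      have h1 := hpd θ
      have h2 := hzp θ
      have h3 : s * T ≤ T := mul_le_of_le_one_left hT0 hs1
      linarith
    rw [e1]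
    refine (abs_add_le _ _).trans (add_le_add ?_ ?_)
    · rw [abs_mul]
      exact mul_le_mul (hWb θ) e2 (abs_nonneg _) (by positivity)
    · rw [abs_mul, abs_mul, abs_of_nonneg (show 0 ≤ s ^ 2 by positivity)]
      exact mul_le_mul (mul_le_mul_of_nonneg_left (hdM θ) (by positivity)) (hpd θ)
        (abs_nonneg _) (by positivity)
  have A1 : |a + ε * s ^ 2 * kx| ≤ |ε| * s ^ 2 * (2 * η') := by
    have e : π * (a + ε * s ^ 2 * kx) =
        -(ε * ((∫ θ in (0 : ℝ)..2 * π, W θ * cos θ) - s ^ 2 * (π * kx))) := by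
      rw [mul_add, ha]
      ring
    have e' := congrArg abs e
    rw [abs_neg, abs_mul, abs_mul, abs_of_pos hπ] at e'
    have := mul_le_mul_of_nonneg_left I1 (abs_nonneg ε)
    refine le_of_mul_le_mul_left ?_ hπ
    rw [e']
    linarith
  have A2 : |(a * z.re + b * z.im) + ε * s ^ 2 * (kx * z.re + ky * z.im)| ≤
      |ε| * s ^ 2 * (4 * (B + T) * η' + 4 * (M * T) * s) := by
    have e : π * ((a * z.re + b * z.im) + ε * s ^ 2 * (kx * z.re + ky * z.im)) =
        -(ε * ((∫ θ in (0 : ℝ)..2 * π, W θ * (u θ * cos θ + v θ * sin θ)) -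
          s ^ 2 * (π * (kx * z.re + ky * z.im)))) := by
      linear_combination hb
    have e' := congrArg abs e
    rw [abs_neg, abs_mul, abs_mul, abs_of_pos hπ] at e'
    have := mul_le_mul_of_nonneg_left I2 (abs_nonneg ε)
    refine le_of_mul_le_mul_left ?_ hπ
    rw [e']
    linarith
  have hε0 : 0 ≤ |ε| * s ^ 2 := by positivity
  refine ⟨A1.trans (mul_le_mul_of_nonneg_left ?_ hε0), ?_⟩
  · have := min_le_left (η / 2) (η * y₀ / (8 * (2 * B + T + 1)))
    linarith
  · have hη'' : η' * (8 * (2 * B + T + 1)) ≤ η * y₀ := by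
      have := min_le_right (η / 2) (η * y₀ / (8 * (2 * B + T + 1)))
      rwa [le_div_iff₀ (by positivity)] at this
    have A3 : |z.re * (a + ε * s ^ 2 * kx)| ≤ B * (|ε| * s ^ 2 * (2 * η')) := by
      rw [abs_mul]
      exact mul_le_mul hre A1 (abs_nonneg _) hB
    -- At `z` the dilation field is `(z₁, z₂)`, so subtracting `z₁` times the translation identity
    -- isolates the second component.
    have e : (b + ε * s ^ 2 * ky) * z.im =
        ((a * z.re + b * z.im) + ε * s ^ 2 * (kx * z.re + ky * z.im)) -
          z.re * (a + ε * s ^ 2 * kx) := by ring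
    have e' := congrArg abs e
    rw [abs_mul, abs_of_pos hz0] at e'
    have e2 := abs_sub ((a * z.re + b * z.im) + ε * s ^ 2 * (kx * z.re + ky * z.im))
      (z.re * (a + ε * s ^ 2 * kx))
    refine le_of_mul_le_mul_right ?_ hz0
    rw [e']
    refine (e2.trans (add_le_add A2 A3)).trans ?_
    have e3 : |ε| * s ^ 2 * (4 * (B + T) * η' + 4 * (M * T) * s) + B * (|ε| * s ^ 2 * (2 * η')) =
        |ε| * s ^ 2 * (η' * (6 * B + 4 * T) + 4 * (M * T) * s) := by ring
    rw [e3, mul_assoc (|ε| * s ^ 2) η]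
    refine mul_le_mul_of_nonneg_left ?_ hε0
    have e4 : η * y₀ ≤ η * z.im := by gcongr
    have e5 : η' * (6 * B + 4 * T) ≤ η' * (4 * (2 * B + T + 1)) := by
      refine mul_le_mul_of_nonneg_left ?_ hη'0.le
      linarith
    linarith

end MultiplierAsymptotics

/-! ### Curves solving the curvature equation up to a multiplier. -/

section CurveFamily

open Real MeasureTheory intervalIntegral

/-- For small `s`, closed curves of mean `z`, close to the circle of radius `s z₂`, whose curvature
is `s⁻¹ + ε g (im)²` up to a multiplier `a cos + b sin`. -/
theorem exists_curve_family {g : ℂ → ℝ} (hg : ContDiff ℝ 1 g) (hgc : HasCompactSupport g)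
    {Z : Set ℂ} {B y₀ : ℝ} (hB : ∀ z ∈ Z, ‖z‖ ≤ B) (hy₀ : 0 < y₀)
    (hy : ∀ z ∈ Z, 2 * y₀ ≤ z.im) :
    ∃ s₀ > 0, ∃ C ≥ 0, ∀ s ε : ℝ, 0 < s → s < s₀ → |ε| ≤ 1 →
      ∃ (r u v : ℂ → C(Circle, ℝ)) (a b : ℂ → ℝ), ContinuousOn a Z ∧ ContinuousOn b Z ∧
      (∀ z ∈ Z, IsAngleCurve (fun θ => r z (Circle.exp θ)) (fun θ => u z (Circle.exp θ))
        (fun θ => v z (Circle.exp θ))) ∧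
      (∀ z ∈ Z, ∫ θ in (0 : ℝ)..2 * π, u z (Circle.exp θ) = 2 * π * z.re) ∧
      (∀ z ∈ Z, ∫ θ in (0 : ℝ)..2 * π, v z (Circle.exp θ) = 2 * π * z.im) ∧
      (∀ z ∈ Z, ∀ θ : ℝ, |r z (Circle.exp θ) - s * z.im| ≤ C * s ^ 2) ∧
      (∀ z ∈ Z, ∀ θ : ℝ, ‖(⟨u z (Circle.exp θ), v z (Circle.exp θ)⟩ : ℂ) - z -
        (s * z.im) • (⟨cos θ, sin θ⟩ : ℂ)‖ ≤ C * s ^ 2) ∧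
      (∀ z ∈ Z, ∀ θ : ℝ, v z (Circle.exp θ) -
        (a z * cos θ + b z * sin θ) * v z (Circle.exp θ) ^ 2 = r z (Circle.exp θ) *
          (s⁻¹ + ε * (g ⟨u z (Circle.exp θ), v z (Circle.exp θ)⟩ * v z (Circle.exp θ) ^ 2) +
            sin θ)) ∧
      (∀ z ∈ Z, ∀ w ∈ Z, ∀ θ : ℝ,
        |r w (Circle.exp θ) - r z (Circle.exp θ)| ≤ C * ‖w - z‖) ∧
      (∀ z ∈ Z, ∀ w ∈ Z, ∀ θ : ℝ, ‖(⟨u w (Circle.exp θ), v w (Circle.exp θ)⟩ -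
        ⟨u z (Circle.exp θ), v z (Circle.exp θ)⟩ : ℂ)‖ ≤ C * ‖w - z‖) := by
  have hKd : ContDiff ℝ 1 fun z : ℂ => g z * z.im ^ 2 := hg.mul (Complex.imCLM.contDiff.pow 2)
  have hKc : HasCompactSupport fun z : ℂ => g z * z.im ^ 2 := hgc.mul_right
  obtain ⟨M, hM⟩ := hKc.exists_bound_of_continuous hKd.continuous
  obtain ⟨L, hL⟩ := ContDiff.lipschitzWith_of_hasCompactSupport hKc hKd one_ne_zero
  set κ : C(ℂ, ℝ) := ⟨fun z => g z * z.im ^ 2, hKd.continuous⟩ with hκ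
  have hL' : ∀ z w, |κ z - κ w| ≤ L * ‖z - w‖ := fun z w => by
    simpa [hκ, Real.dist_eq, dist_eq_norm] using hL.dist_le_mul z w
  obtain ⟨s₀, hs₀, C, hC, h⟩ := exists_profile (κ := κ) hM hL' hB (y₀ := 2 * y₀) (by positivity) hy
  set n := ‖nonharmonicPart‖ + ‖curveRe‖ + ‖curveIm‖ with hn
  have hn0 : 0 ≤ n := by positivity
  have hnQ : ‖nonharmonicPart‖ ≤ n := by
    have := norm_nonneg curveRe
    have := norm_nonneg curveIm
    linarith
  have hn12 : ‖curveRe‖ + ‖curveIm‖ ≤ n := by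
    have := norm_nonneg nonharmonicPart
    linarith
  refine ⟨min 1 s₀, by positivity, n * C + 3 * n + 1, by positivity, fun s ε hs hss hε => ?_⟩
  have hs1 : s ≤ 1 := (hss.trans_le (min_le_left _ _)).le
  obtain ⟨f, hfix, hclose, hlip⟩ := h s ε hs (hss.trans_le (min_le_right _ _)) hε
  have hfc : ContinuousOn f Z :=
    (LipschitzOnWith.of_dist_le_mul (K := 3) fun w hw z hz => by
      simpa [dist_eq_norm] using hlip z hz w hw).continuousOn
  have hpt : ∀ (A : C(Circle, ℝ) →L[ℝ] C(Circle, ℝ)) (p q : C(Circle, ℝ)) (x : Circle),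
      |A p x - A q x| ≤ ‖A‖ * ‖p - q‖ := fun A p q x => by
    have h1 := (A (p - q)).norm_coe_le_norm x
    rw [map_sub] at h1
    exact h1.trans ((congrArg norm (map_sub A p q)).symm.le.trans (A.le_opNorm _))
  have hzy : ∀ z ∈ Z, z.im ≠ 0 := fun z hz => by
    have := hy z hz
    linarith
  -- The nonharmonic part of the profile is the rescaled speed; the harmonic part, divided by `z₂²`,
  -- is the multiplier.
  refine ⟨fun z => s • nonharmonicPart (f z),
    fun z => ContinuousMap.const _ z.re + s • curveRe (f z),
    fun z => ContinuousMap.const _ z.im + s • curveIm (f z),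
    fun z => cosCoeff (f z) / z.im ^ 2, fun z => sinCoeff (f z) / z.im ^ 2,
    ?_, ?_, fun z hz => ?_, fun z hz => ?_, fun z hz => ?_, fun z hz θ => ?_, fun z hz θ => ?_,
    fun z hz θ => ?_, fun z hz w hw θ => ?_, fun z hz w hw θ => ?_⟩
  · exact (cosCoeff.continuous.comp_continuousOn hfc).div (by fun_prop)
      fun z hz => pow_ne_zero 2 (hzy z hz)
  · exact (sinCoeff.continuous.comp_continuousOn hfc).div (by fun_prop)
      fun z hz => pow_ne_zero 2 (hzy z hz)
  · refine ⟨continuous_comp_exp _, fun θ => ?_, fun θ => ?_, ?_, ?_⟩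
    · refine (((hasDerivAt_curveRe (f z) θ).const_mul s).const_add z.re).congr_deriv ?_
      simp only [ContinuousMap.smul_apply, smul_eq_mul]
      ring
    · refine (((hasDerivAt_curveIm (f z) θ).const_mul s).const_add z.im).congr_deriv ?_
      simp only [ContinuousMap.smul_apply, smul_eq_mul]
      ring
    · simp only [Circle.exp_two_pi, Circle.exp_zero]
    · simp only [Circle.exp_two_pi, Circle.exp_zero]
  · rw [integral_comp_exp, map_add, map_smul, circleMean_const, circleMean_curveRe, smul_zero,
      add_zero]
  · rw [integral_comp_exp, map_add, map_smul, circleMean_const, circleMean_curveIm, smul_zero,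
      add_zero]
  · have h1 := hpt nonharmonicPart (f z) (ContinuousMap.const _ z.im) (Circle.exp θ)
    rw [nonharmonicPart_const] at h1
    simp only [ContinuousMap.smul_apply, smul_eq_mul, ContinuousMap.const_apply] at h1 ⊢
    rw [← mul_sub, abs_mul, abs_of_pos hs]
    calc s * |nonharmonicPart (f z) (Circle.exp θ) - z.im| ≤ s * (n * (C * s)) := by
          gcongr
          exact h1.trans (mul_le_mul hnQ (hclose z hz) (norm_nonneg _) hn0)
      _ = n * C * s ^ 2 := by ring
      _ ≤ (n * C + 3 * n + 1) * s ^ 2 := by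
          gcongr
          linarith
  · have h1 := hpt curveRe (f z) (ContinuousMap.const _ z.im) (Circle.exp θ)
    have h2 := hpt curveIm (f z) (ContinuousMap.const _ z.im) (Circle.exp θ)
    rw [curveRe_const] at h1
    rw [curveIm_const] at h2
    simp only [ContinuousMap.smul_apply, smul_eq_mul, circleCos_exp, circleSin_exp] at h1 h2
    refine (Complex.norm_le_abs_re_add_abs_im _).trans ?_
    have e1 : ((⟨z.re + s * curveRe (f z) (Circle.exp θ), z.im + s * curveIm (f z) (Circle.exp θ)⟩ :
        ℂ) - z - (s * z.im) • (⟨cos θ, sin θ⟩ : ℂ)).re =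
        s * (curveRe (f z) (Circle.exp θ) - z.im * cos θ) := by
      simp only [Complex.sub_re, Complex.smul_re, smul_eq_mul]
      ring
    have e2 : ((⟨z.re + s * curveRe (f z) (Circle.exp θ), z.im + s * curveIm (f z) (Circle.exp θ)⟩ :
        ℂ) - z - (s * z.im) • (⟨cos θ, sin θ⟩ : ℂ)).im =
        s * (curveIm (f z) (Circle.exp θ) - z.im * sin θ) := by
      simp only [Complex.sub_im, Complex.smul_im, smul_eq_mul]
      ring
    simp only [ContinuousMap.add_apply, ContinuousMap.const_apply, ContinuousMap.smul_apply,
      smul_eq_mul]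
    rw [e1, e2, abs_mul, abs_mul, abs_of_pos hs, ← mul_add]
    calc s * (|curveRe (f z) (Circle.exp θ) - z.im * cos θ| +
          |curveIm (f z) (Circle.exp θ) - z.im * sin θ|) ≤ s * (n * (C * s)) := by
          gcongr
          refine (add_le_add h1 h2).trans ?_
          rw [← add_mul]
          exact mul_le_mul hn12 (hclose z hz) (norm_nonneg _) hn0
      _ = n * C * s ^ 2 := by ring
      _ ≤ (n * C + 3 * n + 1) * s ^ 2 := by
          gcongr
          linarith
  -- The profile equation at one angle, rearranged by means of `v² = z₂² + s curveIm f (2 z₂ + s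
  -- curveIm f)`.
  · have h1 := congrArg (fun p : C(Circle, ℝ) => p (Circle.exp θ)) (hfix z hz)
    have h2 := harmonicPart_exp (f z) θ
    have h3 : nonharmonicPart (f z) (Circle.exp θ) =
        f z (Circle.exp θ) - harmonicPart (f z) (Circle.exp θ) := rfl
    have h4 : profileCurve s z (f z) (Circle.exp θ) =
        ⟨z.re + s * curveRe (f z) (Circle.exp θ), z.im + s * curveIm (f z) (Circle.exp θ)⟩ := by
      apply Complex.ext <;> simp [profileCurve]
    simp only [profileMap, ContinuousMap.add_apply, ContinuousMap.const_apply,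
      ContinuousMap.smul_apply, ContinuousMap.sub_apply, ContinuousMap.mul_apply, smul_eq_mul,
      ContinuousMap.one_apply, ContinuousMap.comp_apply, circleSin_exp, h4] at h1 ⊢
    simp only [hκ, ContinuousMap.coe_mk] at h1
    have hz0 := hzy z hz
    have hs0 := hs.ne'
    have h5 : cosCoeff (f z) / z.im ^ 2 * cos θ + sinCoeff (f z) / z.im ^ 2 * sin θ =
        harmonicPart (f z) (Circle.exp θ) * (z.im * z.im)⁻¹ := by
      rw [h2]
      field_simp
    have h6 : z.im * z.im * (z.im * z.im)⁻¹ = 1 := mul_inv_cancel₀ (mul_ne_zero hz0 hz0)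
    have h7 : s * s⁻¹ = 1 := mul_inv_cancel₀ hs0
    rw [h5]
    generalize (z.im * z.im)⁻¹ = t at *
    generalize s⁻¹ = k at *
    linear_combination (-1 : ℝ) * h1 - h3 - harmonicPart (f z) (Circle.exp θ) * h6 -
      nonharmonicPart (f z) (Circle.exp θ) * h7
  · have h1 := hpt nonharmonicPart (f w) (f z) (Circle.exp θ)
    simp only [ContinuousMap.smul_apply, smul_eq_mul]
    rw [← mul_sub, abs_mul, abs_of_pos hs]
    calc s * |nonharmonicPart (f w) (Circle.exp θ) - nonharmonicPart (f z) (Circle.exp θ)|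
        ≤ 1 * (n * (3 * ‖w - z‖)) := by
          gcongr
          exact h1.trans (mul_le_mul hnQ (hlip z hz w hw) (norm_nonneg _) hn0)
      _ = 3 * n * ‖w - z‖ := by ring
      _ ≤ (n * C + 3 * n + 1) * ‖w - z‖ := by
          gcongr
          have : 0 ≤ n * C := by positivity
          linarith
  · have h1 := hpt curveRe (f w) (f z) (Circle.exp θ)
    have h2 := hpt curveIm (f w) (f z) (Circle.exp θ)
    have e : ((⟨z.re + s * curveRe (f z) (Circle.exp θ), z.im + s * curveIm (f z) (Circle.exp θ)⟩ :
        ℂ)) = z + s • (⟨curveRe (f z) (Circle.exp θ), curveIm (f z) (Circle.exp θ)⟩ : ℂ) := by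
      apply Complex.ext <;> simp
    have e' : ((⟨w.re + s * curveRe (f w) (Circle.exp θ), w.im + s * curveIm (f w) (Circle.exp θ)⟩ :
        ℂ)) = w + s • (⟨curveRe (f w) (Circle.exp θ), curveIm (f w) (Circle.exp θ)⟩ : ℂ) := by
      apply Complex.ext <;> simp
    simp only [ContinuousMap.add_apply, ContinuousMap.const_apply, ContinuousMap.smul_apply,
      smul_eq_mul]
    rw [e, e', add_sub_add_comm, ← smul_sub]
    have h3 : ‖(⟨curveRe (f w) (Circle.exp θ), curveIm (f w) (Circle.exp θ)⟩ -
        ⟨curveRe (f z) (Circle.exp θ), curveIm (f z) (Circle.exp θ)⟩ : ℂ)‖ ≤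
        n * (3 * ‖w - z‖) := by
      refine (Complex.norm_le_abs_re_add_abs_im _).trans ?_
      refine (add_le_add h1 h2).trans ?_
      rw [← add_mul]
      exact mul_le_mul hn12 (hlip z hz w hw) (norm_nonneg _) hn0
    refine (norm_add_le _ _).trans ?_
    rw [norm_smul, Real.norm_of_nonneg hs.le]
    have h4 := mul_le_mul hs1 h3 (norm_nonneg _) zero_le_one
    have : 0 ≤ n * C * ‖w - z‖ := by positivity
    linarith

end CurveFamily

/-! ### From solutions of the equation to embedded loops. -/

section Loops

open Real

/-- Along an arc whose normal turns by at most `π`, the component in the tangent direction at the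
middle angle `μ` has derivative `r cos (θ - μ)`, positive in the interior, hence is strictly
increasing. -/
lemma IsAngleCurve.ne_of_sub_le_pi {r u v : ℝ → ℝ} (h : IsAngleCurve r u v) (hr : ∀ θ, 0 < r θ)
    {s t : ℝ} (hst : s < t) (hπ : t - s ≤ π) : (⟨u s, v s⟩ : ℂ) ≠ ⟨u t, v t⟩ := by
  intro heq
  have hu : u s = u t := congrArg Complex.re heq
  have hv : v s = v t := congrArg Complex.im heq
  set μ := (s + t) / 2 with hμ
  have hd : ∀ θ, HasDerivAt (fun θ => -(u θ * sin μ) + v θ * cos μ) (r θ * cos (θ - μ)) θ :=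
    fun θ => by
      refine (((h.hasDerivAt_fst θ).mul_const (sin μ)).fun_neg.fun_add
        ((h.hasDerivAt_snd θ).mul_const (cos μ))).congr_deriv ?_
      rw [cos_sub]
      ring
  have hmono : StrictMonoOn (fun θ => -(u θ * sin μ) + v θ * cos μ) (Set.Icc s t) := by
    refine strictMonoOn_of_deriv_pos (convex_Icc s t)
      (fun θ _ => (hd θ).continuousAt.continuousWithinAt) fun θ hθ => ?_
    rw [interior_Icc] at hθ
    rw [(hd θ).deriv]
    refine mul_pos (hr θ) (cos_pos_of_mem_Ioo ⟨?_, ?_⟩)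
    · linarith [hθ.1]
    · linarith [hθ.2]
  have := hmono (Set.left_mem_Icc.2 hst.le) (Set.right_mem_Icc.2 hst.le) hst
  simp only [hu, hv] at this
  exact lt_irrefl _ this

/-- Of the two arcs joining two distinct points of the circle, one has length at most `π`. -/
lemma IsAngleCurve.injective {r u v : C(Circle, ℝ)}
    (h : IsAngleCurve (fun θ => r (Circle.exp θ)) (fun θ => u (Circle.exp θ))
      (fun θ => v (Circle.exp θ))) (hr : ∀ x, 0 < r x) :
    Function.Injective fun x => (⟨u x, v x⟩ : ℂ) := by
  have key : ∀ s t : ℝ, s < t → t < s + 2 * π →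
      (⟨u (Circle.exp s), v (Circle.exp s)⟩ : ℂ) ≠ ⟨u (Circle.exp t), v (Circle.exp t)⟩ := by
    intro s t hst hts
    rcases le_total (t - s) π with hπ | hπ
    · exact h.ne_of_sub_le_pi (fun θ => hr _) hst hπ
    · have := h.ne_of_sub_le_pi (fun θ => hr _) hts (by linarith)
      simp only [Circle.exp_add_two_pi] at this
      exact this.symm
  intro x y hxy
  simp only at hxy
  by_contra hne
  have hne' : Complex.arg x ≠ Complex.arg y := fun h' => hne (Circle.arg_eq_arg.1 h')
  have h1 := Complex.neg_pi_lt_arg x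
  have h2 := Complex.neg_pi_lt_arg y
  have h3 := Complex.arg_le_pi x
  have h4 := Complex.arg_le_pi y
  rw [← Circle.exp_arg x, ← Circle.exp_arg y] at hxy
  rcases lt_or_gt_of_ne hne' with hlt | hlt
  · exact key _ _ hlt (by linarith) hxy
  · exact key _ _ hlt (by linarith) hxy.symm

/-- The Euclidean curvature is `1 / r`; the conformal factor `1 / y` multiplies it by the height and
adds the vertical component `-sin θ` of the inner normal. -/
lemma geodesicCurvature_eq {c : ℝ → ℂ} {θ r r' : ℝ} (hc : 0 < (c θ).im) (hr : 0 < r)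
    (h1 : deriv c θ = ⟨-(r * sin θ), r * cos θ⟩)
    (h2 : deriv (deriv c) θ = ⟨-(r' * sin θ + r * cos θ), r' * cos θ - r * sin θ⟩) :
    geodesicCurvature c θ = (c θ).im / r - sin θ := by
  have hsc := sin_sq_add_cos_sq θ
  have hn : hypNorm (c θ) (deriv c θ) = r / (c θ).im := by
    have : hypInner (c θ) (deriv c θ) (deriv c θ) = (r / (c θ).im) ^ 2 := by
      rw [hypInner, h1, Complex.inner, div_pow]
      congr 1
      simp only [Complex.mul_re, Complex.conj_re, Complex.conj_im]
      linear_combination r ^ 2 * hsc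
    rw [hypNorm, this, Real.sqrt_sq (by positivity)]
  have hi : hypInner (c θ) (hypAccel c θ) (Complex.I * deriv c θ) =
      (r ^ 2 - r ^ 3 * sin θ / (c θ).im) / (c θ).im ^ 2 := by
    rw [hypInner, hypAccel, h1, h2, Complex.inner]
    congr 1
    have e1 : Complex.I * (⟨-(r * sin θ), r * cos θ⟩ : ℂ) = ⟨-(r * cos θ), -(r * sin θ)⟩ := by
      apply Complex.ext <;> simp
    have e2 : -Complex.I * (⟨-(r * sin θ), r * cos θ⟩ : ℂ) ^ 2 =
        ⟨-(2 * r ^ 2 * sin θ * cos θ), r ^ 2 * (cos θ ^ 2 - sin θ ^ 2)⟩ := by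
      apply Complex.ext
      · simp [pow_two]
        ring
      · simp [pow_two]
        ring
    rw [e1, e2]
    simp only [Complex.mul_re, Complex.conj_re, Complex.conj_im, Complex.sub_re, Complex.sub_im,
      Complex.mul_im, Complex.ofReal_re, Complex.ofReal_im]
    rw [div_eq_mul_inv]
    linear_combination (r ^ 2 - (c θ).im⁻¹ * r ^ 3 * sin θ) * hsc
  rw [geodesicCurvature, hn, hi]
  field_simp

/-- A closed curve with positive speed in the angle of the normal that solves the curvature
equation is an embedded loop. -/
theorem IsAngleCurve.isEmbeddedKLoop {K : ℂ → ℝ} (hK : ContDiff ℝ 1 K) {r u v : C(Circle, ℝ)}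
    (h : IsAngleCurve (fun θ => r (Circle.exp θ)) (fun θ => u (Circle.exp θ))
      (fun θ => v (Circle.exp θ))) (hr : ∀ x, 0 < r x) (hv : ∀ x, 0 < v x) {k ε : ℝ}
    (heq : ∀ θ : ℝ, v (Circle.exp θ) = r (Circle.exp θ) *
      (k + ε * K ⟨u (Circle.exp θ), v (Circle.exp θ)⟩ + sin θ)) :
    IsEmbeddedKLoop (fun z => k + ε * K z) (fun x => ⟨u x, v x⟩) ∧
    (∀ θ : ℝ, ‖deriv (angular fun x => ⟨u x, v x⟩) θ‖ ≤ r (Circle.exp θ)) ∧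
    ∀ θ : ℝ, ‖deriv (deriv (angular fun x => ⟨u x, v x⟩)) θ‖ ≤ r (Circle.exp θ) +
      |ε| * r (Circle.exp θ) ^ 3 * ‖fderiv ℝ K ⟨u (Circle.exp θ), v (Circle.exp θ)⟩‖ /
        v (Circle.exp θ) := by
  set c : ℝ → ℂ := angular fun x => ⟨u x, v x⟩ with hc
  have hcθ : ∀ θ, c θ = ⟨u (Circle.exp θ), v (Circle.exp θ)⟩ := fun θ => rfl
  set ρ : ℝ → ℝ := fun θ => r (Circle.exp θ) with hρ
  have hρ0 : ∀ θ, 0 < ρ θ := fun θ => hr _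
  have hd : ∀ θ, HasDerivAt c ⟨-(ρ θ * sin θ), ρ θ * cos θ⟩ θ := fun θ => by
    have h1 := (h.hasDerivAt_fst θ).ofReal_comp.add
      ((h.hasDerivAt_snd θ).ofReal_comp.mul_const Complex.I)
    rw [Complex.mk_eq_add_mul_I]
    have : c = (fun θ : ℝ => ((u (Circle.exp θ) : ℝ) : ℂ)) +
        fun θ : ℝ => ((v (Circle.exp θ) : ℝ) : ℂ) * Complex.I := by
      ext θ
      rw [hcθ, Complex.mk_eq_add_mul_I]
      rfl
    rw [this]
    exact h1
  have hderiv : deriv c = fun θ => (⟨-(ρ θ * sin θ), ρ θ * cos θ⟩ : ℂ) :=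
    funext fun θ => (hd θ).deriv
  have hsmooth : ∀ n : WithTop ℕ∞, ContDiff ℝ n ρ → ContDiff ℝ n (deriv c) := fun n hn => by
    rw [hderiv]
    simp only [Complex.mk_eq_add_mul_I]
    exact (Complex.ofRealCLM.contDiff.comp (hn.mul contDiff_sin).neg).add
      ((Complex.ofRealCLM.contDiff.comp (hn.mul contDiff_cos)).mul contDiff_const)
  have hdiff : Differentiable ℝ c := fun θ => (hd θ).differentiableAt
  have hc1 : ContDiff ℝ 1 c := by
    rw [contDiff_one_iff_deriv]
    exact ⟨hdiff, (hsmooth 0 (contDiff_zero.2 h.continuous_speed)).continuous⟩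
  have hden : ∀ θ, k + ε * K (c θ) + sin θ ≠ 0 := fun θ h0 => by
    have := heq θ
    rw [← hcθ, h0, mul_zero] at this
    exact (hv _).ne' this
  have hρeq : ρ = fun θ => (c θ).im / (k + ε * K (c θ) + sin θ) := by
    ext θ
    rw [eq_div_iff (hden θ)]
    exact (heq θ).symm
  -- Bootstrap: the speed is only continuous a priori, but the equation expresses it through the
  -- curve, which is already `C¹`.
  have hρ1 : ContDiff ℝ 1 ρ := by
    rw [hρeq]
    exact (Complex.imCLM.contDiff.comp hc1).div
      ((contDiff_const.add (contDiff_const.mul (hK.comp hc1))).add contDiff_sin) hden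
  have hc2 : ContDiff ℝ 2 c := by
    rw [show (2 : WithTop ℕ∞) = 1 + 1 from rfl, contDiff_succ_iff_deriv]
    exact ⟨hdiff, fun h => absurd h (by decide), hsmooth 1 hρ1⟩
  have hρd : ∀ θ, HasDerivAt ρ (deriv ρ θ) θ := fun θ =>
    (hρ1.differentiable one_ne_zero θ).hasDerivAt
  have hd2 : ∀ θ, deriv (deriv c) θ =
      ⟨-(deriv ρ θ * sin θ + ρ θ * cos θ), deriv ρ θ * cos θ - ρ θ * sin θ⟩ := fun θ => by
    have h1 := ((hρd θ).mul (hasDerivAt_sin θ)).neg.ofReal_comp.add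
      (((hρd θ).mul (hasDerivAt_cos θ)).ofReal_comp.mul_const Complex.I)
    have h2 : deriv c = (fun θ : ℝ => ((-(ρ * sin) θ : ℝ) : ℂ)) +
        fun θ : ℝ => (((ρ * cos) θ : ℝ) : ℂ) * Complex.I := by
      rw [hderiv]
      ext θ
      rw [Complex.mk_eq_add_mul_I]
      rfl
    rw [h2]
    refine h1.deriv.trans ?_
    rw [Complex.mk_eq_add_mul_I]
    push_cast
    ring
  have hregular : ∀ θ, deriv c θ ≠ 0 := fun θ h0 => by
    rw [hderiv] at h0
    have h1 : -(ρ θ * sin θ) = 0 := congrArg Complex.re h0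
    have h2 : ρ θ * cos θ = 0 := congrArg Complex.im h0
    have h3 := sin_sq_add_cos_sq θ
    have h4 : ρ θ ^ 2 = 0 := by
      linear_combination (-(ρ θ * sin θ)) * h1 + (ρ θ * cos θ) * h2 - ρ θ ^ 2 * h3
    exact (pow_pos (hρ0 θ) 2).ne' h4
  have hcurv : ∀ θ, geodesicCurvature c θ = k + ε * K (c θ) := fun θ => by
    rw [geodesicCurvature_eq (hv _) (hρ0 θ) (hd θ).deriv (hd2 θ)]
    rw [sub_eq_iff_eq_add, div_eq_iff (hρ0 θ).ne', mul_comm]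
    exact heq θ
  have hunit : ∀ x y θ : ℝ, ‖(⟨-(x * sin θ + y * cos θ), x * cos θ - y * sin θ⟩ : ℂ)‖ ≤
      |y| + |x| := fun x y θ => by
    rw [Complex.norm_def, Complex.normSq_mk]
    refine Real.sqrt_le_iff.2 ⟨by positivity, ?_⟩
    have h1 := sin_sq_add_cos_sq θ
    have h2 : -(x * sin θ + y * cos θ) * -(x * sin θ + y * cos θ) +
        (x * cos θ - y * sin θ) * (x * cos θ - y * sin θ) = x ^ 2 + y ^ 2 := by
      linear_combination (x ^ 2 + y ^ 2) * h1
    rw [h2, ← sq_abs x, ← sq_abs y]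
    have := mul_nonneg (abs_nonneg x) (abs_nonneg y)
    nlinarith
  refine ⟨⟨⟨⟨fun x => hv x, hc2, hregular⟩, hcurv⟩, h.injective hr⟩, fun θ => ?_, fun θ => ?_⟩
  · have h1 := hunit (ρ θ) 0 θ
    simp only [zero_mul, add_zero, sub_zero, abs_zero, zero_add, abs_of_pos (hρ0 θ)] at h1
    rw [(hd θ).deriv]
    exact h1
  · rw [hd2]
    refine (hunit _ _ θ).trans ?_
    rw [abs_of_pos (hρ0 θ)]
    gcongr
    have hKd := (hK.differentiable one_ne_zero (c θ)).hasFDerivAt.comp_hasDerivAt θ (hd θ)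
    have h1 := (hρd θ).fun_mul (((hKd.const_mul ε).const_add k).fun_add (hasDerivAt_sin θ))
    have h2 : (fun θ => ρ θ * (k + ε * (K ∘ c) θ + sin θ)) = fun θ => v (Circle.exp θ) :=
      funext fun θ => (heq θ).symm
    rw [h2] at h1
    have h3 := h1.unique (h.hasDerivAt_snd θ)
    have h4 := heq θ
    set d := fderiv ℝ K (c θ) ⟨-(ρ θ * sin θ), ρ θ * cos θ⟩
    have hdn : |d| ≤ ‖fderiv ℝ K (c θ)‖ * ρ θ := by
      refine ((fderiv ℝ K (c θ)).le_opNorm _).trans ?_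
      gcongr
      have := hunit (ρ θ) 0 θ
      simpa [abs_of_pos (hρ0 θ)] using this
    -- The derivative of the equation, times `r`. The terms `r cos θ` on both sides cancel, so `r'`
    -- is of order `ε r³` and does not spoil smallness of the second derivative.
    have h5 : deriv ρ θ * v (Circle.exp θ) = -(ε * ρ θ ^ 2 * d) := by
      simp only [Function.comp_apply, hcθ] at h3
      rw [h4]
      change _ = _ at h3
      linear_combination ρ θ * h3
    have hv0 := hv (Circle.exp θ)
    rw [le_div_iff₀ hv0]
    have h6 := congrArg abs h5
    rw [abs_mul, abs_of_pos hv0, abs_neg, abs_mul, abs_mul,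
      abs_of_pos (pow_pos (hρ0 θ) 2)] at h6
    rw [h6]
    calc |ε| * ρ θ ^ 2 * |d| ≤ |ε| * ρ θ ^ 2 * (‖fderiv ℝ K (c θ)‖ * ρ θ) := by gcongr
      _ = |ε| * ρ θ ^ 3 * ‖fderiv ℝ K (c θ)‖ := by ring

end Loops

/-! ### Cutting off `K`. -/

section Cutoff

/-- A compactly supported `C¹` function that agrees with `K / (im)²` on a half disc. -/
lemma exists_cutoff {K : ℂ → ℝ} (hK : ContDiffOn ℝ 1 K HypPlane) (R : ℝ) {m : ℝ} (hm : 0 < m) :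
    ∃ g : ℂ → ℝ, ContDiff ℝ 1 g ∧ HasCompactSupport g ∧
      ∀ z, ‖z‖ ≤ R → m ≤ z.im → g z * z.im ^ 2 = K z := by
  set s : Set ℂ := Metric.closedBall 0 R ∩ {z | m ≤ z.im} with hs
  set t : Set ℂ := Metric.closedBall 0 (R + 1) ∩ {z | m / 2 ≤ z.im} with ht
  have hsc : IsClosed s :=
    Metric.isClosed_closedBall.inter (isClosed_le continuous_const Complex.continuous_im)
  have htc : IsCompact t :=
    (isCompact_closedBall _ _).inter_right (isClosed_le continuous_const Complex.continuous_im)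
  have hst : s ⊆ interior t := by
    have hsub : Metric.ball 0 (R + 1) ∩ {z : ℂ | m / 2 < z.im} ⊆ t := fun z hz =>
      ⟨Metric.ball_subset_closedBall hz.1, show m / 2 ≤ z.im from le_of_lt hz.2⟩
    refine Set.Subset.trans ?_ (interior_maximal hsub
      (Metric.isOpen_ball.inter (isOpen_lt continuous_const Complex.continuous_im)))
    intro z hz
    refine ⟨mem_ball_zero_iff.2 ?_, ?_⟩
    · have := mem_closedBall_zero_iff.1 hz.1
      linarith
    · have : m ≤ z.im := hz.2
      change m / 2 < z.im
      linarith
  obtain ⟨χ, hχ1, hχ0, -⟩ := exists_contMDiffMap_one_nhds_of_subset_interior (n := 1)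
    (modelWithCornersSelf ℝ ℂ) hsc hst
  have hχ : ContDiff ℝ 1 χ := χ.contMDiff.contDiff
  refine ⟨fun z => χ z * (K z / z.im ^ 2), contDiff_iff_contDiffAt.2 fun z => ?_,
    HasCompactSupport.intro htc fun z hz => by simp [hχ0 z hz], fun z hz hzm => ?_⟩
  · by_cases hz : z ∈ HypPlane
    · exact hχ.contDiffAt.mul ((hK.contDiffAt (isOpen_hypPlane.mem_nhds hz)).div
        (Complex.imCLM.contDiff.pow 2).contDiffAt (pow_ne_zero 2 (ne_of_gt hz)))
    -- Outside the half-plane the quotient is uncontrolled, but `χ` vanishes in a neighbourhood,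
    -- since `t` is closed and lies in the half-plane.
    · have hzt : z ∉ t := fun h => hz ((half_pos hm).trans_le h.2)
      refine (contDiffAt_const (c := (0 : ℝ))).congr_of_eventuallyEq ?_
      filter_upwards [htc.isClosed.isOpen_compl.mem_nhds hzt] with w hw
      simp [hχ0 w hw]
  · have h1 : χ z = 1 := hχ1.self_of_nhdsSet z ⟨mem_closedBall_zero_iff.2 hz, hzm⟩
    have h2 : z.im ≠ 0 := (hm.trans_le hzm).ne'
    simp only [h1]
    field_simp

end Cutoff

/-! ### Existence of small loops at almost critical points. -/

section Existence

open Real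

lemma clm_eq_reCLM_add_imCLM (L : ℂ →L[ℝ] ℝ) :
    L = L 1 • Complex.reCLM + L Complex.I • Complex.imCLM := by
  ext z
  conv_lhs => rw [← Complex.eta z, mk_eq_smul_one_add_smul_I, map_add, map_smul, map_smul]
  simp [mul_comm]

lemma norm_smul_reCLM_add_smul_imCLM_le (x y : ℝ) :
    ‖x • Complex.reCLM + y • Complex.imCLM‖ ≤ |x| + |y| := by
  refine (norm_add_le _ _).trans ?_
  rw [norm_smul, norm_smul, Complex.reCLM_norm, Complex.imCLM_norm, mul_one, mul_one]
  rfl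

/-- Embedded loops of large curvature near an almost critical point of `K`. -/
theorem exists_loop_near_critical_point {K : ℂ → ℝ} (hK : ContDiffOn ℝ 1 K HypPlane) {A : Set ℂ}
    (hAc : IsCompact (closure A)) (hAH : closure A ⊆ HypPlane) (hstable : HasStableCriticalPoint K A)
    {ρ : ℝ} (hρ : 0 < ρ) :
    ∃ s₀ > 0, ∀ s ε : ℝ, 0 < s → s < s₀ → |ε| ≤ 1 → ∃ z ∈ A, ‖fderiv ℝ K z‖ ≤ ρ ∧
      ∃ u : Circle → ℂ, IsEmbeddedKLoop (fun p => s⁻¹ + ε * K p) u ∧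
        ∀ θ, ‖angular u θ - z‖ ≤ ρ ∧ ‖deriv (angular u) θ‖ ≤ ρ ∧
          ‖deriv (deriv (angular u)) θ‖ ≤ ρ := by
  obtain ⟨r₀, hr₀, hstab⟩ := hstable
  obtain ⟨z₀, hz₀, hz₀K⟩ := hstab K ⟨HypPlane, isOpen_hypPlane, hAH, hK⟩ fun z _ => by simpa using hr₀
  obtain ⟨B, hB⟩ := hAc.isBounded.exists_norm_le
  obtain ⟨zm, hzm, hmin⟩ := hAc.exists_isMinOn ⟨z₀, subset_closure hz₀⟩
    Complex.continuous_im.continuousOn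
  -- Three levels: centres in the closure of `A` have height at least `4 y₀`, their curves stay
  -- above `2 y₀`, where the cut-off function agrees with `K`, and curves with centres in `Z` stay
  -- above `y₀`.
  obtain ⟨y₀, hy₀, hm⟩ : ∃ y₀ > 0, ∀ z ∈ closure A, 4 * y₀ ≤ z.im :=
    ⟨zm.im / 4, div_pos (hAH hzm) (by norm_num), fun z hz => by
      have : zm.im ≤ z.im := hmin hz
      linarith⟩
  have hB0 : 0 ≤ B := (norm_nonneg _).trans (hB z₀ (subset_closure hz₀))
  -- the domain of the centres
  set Z : Set ℂ := Metric.ball 0 (B + 1) ∩ {z | 2 * y₀ < z.im} with hZ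
  have hZo : IsOpen Z :=
    Metric.isOpen_ball.inter (isOpen_lt continuous_const Complex.continuous_im)
  have hZconv : Convex ℝ Z := (convex_ball _ _).inter (convex_halfSpace_im_gt _)
  have hAZ : closure A ⊆ Z := fun z hz => by
    refine ⟨mem_ball_zero_iff.2 ?_, ?_⟩
    · linarith [hB z hz]
    · change 2 * y₀ < z.im
      linarith [hm z hz]
  have hZB : ∀ z ∈ Z, ‖z‖ ≤ B + 1 := fun z hz => (mem_ball_zero_iff.1 hz.1).le
  have hZy : ∀ z ∈ Z, 2 * y₀ ≤ z.im := fun z hz => le_of_lt hz.2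
  have hZH : Z ⊆ HypPlane := fun z hz => by
    change 0 < z.im
    linarith [hZy z hz]
  obtain ⟨g, hg, hgc, hgK⟩ := exists_cutoff hK (B + 1) (m := 2 * y₀) (by positivity)
  set K' : ℂ → ℝ := fun z => g z * z.im ^ 2 with hK'
  have hK'd : ContDiff ℝ 1 K' := hg.mul (Complex.imCLM.contDiff.pow 2)
  have hK'c : HasCompactSupport K' := hgc.mul_right
  have hKK' : ∀ z ∈ Z, K' z = K z := fun z hz => hgK z (hZB z hz) (hZy z hz)
  have hfK : ∀ z ∈ Z, fderiv ℝ K' z = fderiv ℝ K z := fun z hz =>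
    Filter.EventuallyEq.fderiv_eq (Filter.eventuallyEq_of_mem (hZo.mem_nhds hz) hKK')
  obtain ⟨M, hM⟩ := (hK'c.fderiv ℝ).exists_bound_of_continuous
    (hK'd.continuous_fderiv one_ne_zero)
  have hM0 : 0 ≤ M := (norm_nonneg _).trans (hM 0)
  obtain ⟨s₁, hs₁, C, hC, hfam⟩ := exists_curve_family hg hgc hZB hy₀ hZy
  set T := B + 1 + C with hT
  have hT0 : 0 < T := by positivity
  -- The rescaled energy will have gradient within `2 η` of that of `K`, hence values within `2 η`
  -- times the diameter bound `2 (B + 1)` of `Z`; the sum must be less than the stability radius.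
  obtain ⟨η, hη, hηρ, hηr⟩ : ∃ η > 0, 2 * η ≤ ρ ∧ 2 * η * (2 * (B + 1)) + 2 * η < r₀ := by
    refine ⟨min (ρ / 2) (r₀ / (4 * (B + 1) + 4)), by positivity, ?_, ?_⟩
    · linarith [min_le_left (ρ / 2) (r₀ / (4 * (B + 1) + 4))]
    · have h := min_le_right (ρ / 2) (r₀ / (4 * (B + 1) + 4))
      have h0 : 0 < min (ρ / 2) (r₀ / (4 * (B + 1) + 4)) := by positivity
      rw [le_div_iff₀ (by positivity)] at h
      linarith
  obtain ⟨s₂, hs₂, hmult⟩ := exists_multiplier_bound hg (K := K') (fun _ => rfl)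
    (show 0 ≤ B + 1 by positivity) hy₀ hC hη
  set Q := T + M * T ^ 3 / y₀ with hQ
  have hQ0 : 0 < Q := by positivity
  -- All points of a curve are within `s T` of its centre: `s T < y₀` keeps the heights, `s T < 1`
  -- the norms, and `s Q` bounds the second derivative.
  refine ⟨min (min 1 (min s₁ s₂)) (min (min (y₀ / T) (1 / T)) (ρ / Q)), by positivity,
    fun s ε hs hss hε => ?_⟩
  obtain ⟨⟨hs1, hss₁, hss₂⟩, ⟨hsy, hs1T⟩, hsQ⟩ :
      (s < 1 ∧ s < s₁ ∧ s < s₂) ∧ (s < y₀ / T ∧ s < 1 / T) ∧ s < ρ / Q := by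
    simpa only [lt_min_iff] using hss
  rw [lt_div_iff₀ hT0] at hsy hs1T
  rw [lt_div_iff₀ hQ0] at hsQ
  obtain ⟨r, u, v, a, b, hac, hbc, hcurve, hmu, hmv, hr, hc, heq, hlr, hlc⟩ :=
    hfam s ε hs hss₁ hε
  have hCT : C ≤ T := by rw [hT]; linarith
  have hsq : C * s ^ 2 ≤ C * s := by
    gcongr
    nlinarith
  have hzT : ∀ z ∈ Z, s * z.im + C * s ^ 2 ≤ s * T := fun z hz => by
    have h1 : z.im ≤ B + 1 := (le_abs_self _).trans ((Complex.abs_im_le_norm z).trans (hZB z hz))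
    have h2 := mul_le_mul_of_nonneg_left h1 hs.le
    rw [hT]
    linarith
  have hz0 : ∀ z ∈ Z, 0 < z.im := hZH
  have hdist : ∀ z ∈ Z, ∀ θ : ℝ,
      ‖(⟨u z (Circle.exp θ), v z (Circle.exp θ)⟩ : ℂ) - z‖ ≤ s * T := fun z hz θ => by
    have h1 := hc z hz θ
    have h2 : ‖(s * z.im) • (⟨cos θ, sin θ⟩ : ℂ)‖ = s * z.im := by
      have hzim := hz0 z hz
      rw [norm_smul, Real.norm_of_nonneg (by positivity), Complex.norm_def, Complex.normSq_mk,
        ← sq, ← sq, cos_sq_add_sin_sq, Real.sqrt_one, mul_one]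
    have h3 := norm_le_norm_sub_add ((⟨u z (Circle.exp θ), v z (Circle.exp θ)⟩ : ℂ) - z)
      ((s * z.im) • (⟨cos θ, sin θ⟩ : ℂ))
    linarith [hzT z hz]
  have hvim : ∀ z ∈ Z, ∀ θ : ℝ, z.im - s * T ≤ v z (Circle.exp θ) := fun z hz θ => by
    have := (abs_le.1 ((Complex.abs_im_le_norm _).trans (hdist z hz θ))).1
    simp only [Complex.sub_im] at this
    linarith
  have hvy : ∀ z ∈ Z, ∀ θ : ℝ, y₀ ≤ v z (Circle.exp θ) := fun z hz θ => by
    linarith [hvim z hz θ, hZy z hz]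
  have hrT : ∀ z ∈ Z, ∀ θ : ℝ, |r z (Circle.exp θ)| ≤ s * T := fun z hz θ => by
    have h1 := abs_le.1 (hr z hz θ)
    have h2 := hzT z hz
    have h3 : 0 ≤ s * z.im := mul_nonneg hs.le (hz0 z hz).le
    rw [abs_le]
    constructor <;> linarith
  have hrpos : ∀ z ∈ Z, ∀ θ : ℝ, 0 < r z (Circle.exp θ) := fun z hz θ => by
    have h1 := (abs_le.1 (hr z hz θ)).1
    have h2 : C * s < z.im := by
      have := mul_le_mul_of_nonneg_right hCT hs.le
      linarith [hZy z hz]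
    have h3 : 0 < s * (z.im - C * s) := mul_pos hs (by linarith)
    linarith
  have hab : ∀ z ∈ Z, |a z + ε * s ^ 2 * fderiv ℝ K z 1| ≤ |ε| * s ^ 2 * η ∧
      |b z + ε * s ^ 2 * fderiv ℝ K z Complex.I| ≤ |ε| * s ^ 2 * η := fun z hz => by
    rw [← hfK z hz]
    exact hmult s hs hss₂ ε s⁻¹ (a z) (b z) z _ _ _ (hZB z hz) (by linarith [hZy z hz])
      (hcurve z hz) (hmu z hz) (hmv z hz) (hvy z hz) (hr z hz) (hc z hz) (heq z hz)
  -- a centre with vanishing multiplier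
  obtain ⟨z, hzA, hzK, haz, hbz⟩ : ∃ z ∈ A, ‖fderiv ℝ K z‖ ≤ ρ ∧ a z = 0 ∧ b z = 0 := by
    -- For `ε = 0` the energy cannot be rescaled, but the multiplier bound, proportional to `|ε|`,
    -- forces `a = b = 0`.
    rcases eq_or_ne ε 0 with rfl | hε0
    · have h := hab z₀ (hAZ (subset_closure hz₀))
      simp only [zero_mul, add_zero, abs_zero, abs_nonpos_iff] at h
      exact ⟨z₀, hz₀, by rw [hz₀K, norm_zero]; exact hρ.le, h.1, h.2⟩
    have hεs : 0 < |ε| * s ^ 2 := by positivity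
    have hεs' : ε * s ^ 2 ≠ 0 := mul_ne_zero hε0 (by positivity)
    set D : Set ℂ := Metric.closedBall 0 (B + 2) ∩ {z | y₀ ≤ z.im} with hD
    have hDc : IsCompact D :=
      (isCompact_closedBall _ _).inter_right (isClosed_le continuous_const Complex.continuous_im)
    have hDconv : Convex ℝ D := (convex_closedBall _ _).inter (convex_halfSpace_im_ge _)
    have hDH : D ⊆ HypPlane := fun z hz => hy₀.trans_le hz.2
    have hmem : ∀ z ∈ Z, ∀ θ : ℝ,
        (⟨u z (Circle.exp θ), v z (Circle.exp θ)⟩ : ℂ) ∈ D := fun z hz θ => by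
      refine ⟨mem_closedBall_zero_iff.2 ?_, hvy z hz θ⟩
      have h1 := norm_le_norm_sub_add (⟨u z (Circle.exp θ), v z (Circle.exp θ)⟩ : ℂ) z
      linarith [hdist z hz θ, hZB z hz]
    set E : ℂ → ℝ := fun w => curveEnergy g s⁻¹ ε (fun θ => r w (Circle.exp θ))
      (fun θ => u w (Circle.exp θ)) (fun θ => v w (Circle.exp θ)) with hE
    have hEd : ∀ z ∈ Z, HasFDerivAt E
        ((π * a z) • Complex.reCLM + (π * b z) • Complex.imCLM) z := fun z hz =>
      hasFDerivAt_curveEnergy hg hDc hDconv hDH hZo hT0.le hcurve hmem hmu hmv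
        (fun z hz θ => (hrT z hz θ).trans (mul_le_of_le_one_left hT0.le hs1.le))
        (fun z hz w hw θ => (hlr z hz w hw θ).trans (by gcongr))
        (fun z hz w hw θ => (hlc z hz w hw θ).trans (by gcongr)) heq hz
    -- As `∇E = π (a, b) ≈ -π ε s² ∇K`, this factor turns `∇E` into an approximation of `∇K`; the
    -- constant in `G` makes `G` and `K` agree at `z₀`.
    set t := -(π * (ε * s ^ 2))⁻¹ with ht
    have htπ : t * π = -(ε * s ^ 2)⁻¹ := by
      rw [ht]
      field_simp
    set G : ℂ → ℝ := fun w => t * E w + (K z₀ - t * E z₀) with hG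
    set G' : ℂ → ℂ →L[ℝ] ℝ := fun z =>
      (-(ε * s ^ 2)⁻¹ * a z) • Complex.reCLM + (-(ε * s ^ 2)⁻¹ * b z) • Complex.imCLM with hG'
    have hGd : ∀ z ∈ Z, HasFDerivAt G (G' z) z := fun z hz => by
      refine (((hEd z hz).const_mul t).add_const _).congr_fderiv ?_
      rw [hG', smul_add, smul_smul, smul_smul, ← mul_assoc, ← mul_assoc, htπ]
    have hG'c : ContinuousOn G' Z :=
      ((continuousOn_const.mul hac).smul continuousOn_const).add
        ((continuousOn_const.mul hbc).smul continuousOn_const)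
    have hGsmooth : ContDiffOn ℝ 1 G Z := by
      rw [show (1 : WithTop ℕ∞) = 0 + 1 from rfl, contDiffOn_succ_iff_fderiv_of_isOpen hZo]
      refine ⟨fun z hz => (hGd z hz).differentiableAt.differentiableWithinAt,
        fun h => absurd h (by decide), contDiffOn_zero.2 ?_⟩
      exact hG'c.congr fun z hz => (hGd z hz).fderiv
    have hKdiff : ∀ z ∈ Z, DifferentiableAt ℝ K z := fun z hz =>
      (hK.differentiableOn one_ne_zero).differentiableAt (isOpen_hypPlane.mem_nhds (hZH hz))
    have hquot : ∀ x y : ℝ, |x + ε * s ^ 2 * y| ≤ |ε| * s ^ 2 * η →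
        |-(ε * s ^ 2)⁻¹ * x - y| ≤ η := fun x y hxy => by
      have e : -(ε * s ^ 2)⁻¹ * x - y = -((x + ε * s ^ 2 * y) / (ε * s ^ 2)) := by
        field_simp
        ring
      rw [e, abs_neg, abs_div, abs_mul ε, abs_of_pos (show 0 < s ^ 2 by positivity),
        div_le_iff₀ hεs]
      linarith
    have hclose : ∀ z ∈ Z, ‖G' z - fderiv ℝ K z‖ ≤ 2 * η := fun z hz => by
      have e : G' z - fderiv ℝ K z =
          (-(ε * s ^ 2)⁻¹ * a z - fderiv ℝ K z 1) • Complex.reCLM +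
          (-(ε * s ^ 2)⁻¹ * b z - fderiv ℝ K z Complex.I) • Complex.imCLM := by
        conv_lhs => rw [clm_eq_reCLM_add_imCLM (fderiv ℝ K z)]
        simp only [hG']
        module
      rw [e]
      refine (norm_smul_reCLM_add_smul_imCLM_le _ _).trans ?_
      linarith [hquot _ _ (hab z hz).1, hquot _ _ (hab z hz).2]
    have hz₀Z := hAZ (subset_closure hz₀)
    -- Closeness of the values follows from closeness of the gradients by the mean value inequality
    -- on the convex set `Z`.
    obtain ⟨z, hzA, hzG⟩ := hstab G ⟨Z, hZo, hAZ, hGsmooth⟩ fun z hz => by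
      have hzZ := hAZ hz
      have h1 := hZconv.norm_image_sub_le_of_norm_hasFDerivWithin_le (f := fun w => G w - K w)
        (fun w hw => ((hGd w hw).sub (hKdiff w hw).hasFDerivAt).hasFDerivWithinAt) hclose
        hz₀Z hzZ
      have h2 : G z₀ - K z₀ = 0 := by
        simp only [hG]
        ring
      rw [h2, sub_zero, Real.norm_eq_abs] at h1
      have h3 : ‖z - z₀‖ ≤ 2 * (B + 1) := by
        refine (norm_sub_le _ _).trans ?_
        linarith [hZB z hzZ, hZB z₀ hz₀Z]
      have h4 : 2 * η * ‖z - z₀‖ ≤ 2 * η * (2 * (B + 1)) := by gcongr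
      rw [(hGd z hzZ).fderiv]
      linarith [hclose z hzZ]
    have hzZ := hAZ (subset_closure hzA)
    rw [(hGd z hzZ).fderiv] at hzG
    have h1 := congrArg (fun L : ℂ →L[ℝ] ℝ => L 1) hzG
    have h2 := congrArg (fun L : ℂ →L[ℝ] ℝ => L Complex.I) hzG
    simp [hG', hε0, hs.ne'] at h1 h2
    refine ⟨z, hzA, ?_, h1, h2⟩
    have h3 := hclose z hzZ
    rw [hzG, zero_sub, norm_neg] at h3
    exact h3.trans hηρ
  have hzc := subset_closure hzA
  have hzZ := hAZ hzc
  have hr' : ∀ x, 0 < r z x := fun x => by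
    rw [← Circle.exp_arg x]
    exact hrpos z hzZ _
  have hv' : ∀ x, 0 < v z x := fun x => by
    rw [← Circle.exp_arg x]
    exact hy₀.trans_le (hvy z hzZ _)
  obtain ⟨hloop, hd1, hd2⟩ := (hcurve z hzZ).isEmbeddedKLoop hK'd hr' hv' (k := s⁻¹) (ε := ε)
    fun θ => by
      have := heq z hzZ θ
      rw [haz, hbz] at this
      linarith
  have hmemZ : ∀ θ : ℝ, (⟨u z (Circle.exp θ), v z (Circle.exp θ)⟩ : ℂ) ∈ Z := fun θ => by
    refine ⟨mem_ball_zero_iff.2 ?_, ?_⟩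
    · have h1 := norm_le_norm_sub_add (⟨u z (Circle.exp θ), v z (Circle.exp θ)⟩ : ℂ) z
      linarith [hdist z hzZ θ, hB z hzc]
    · change 2 * y₀ < v z (Circle.exp θ)
      linarith [hvim z hzZ θ, hm z hzc]
  have hrle : ∀ θ : ℝ, r z (Circle.exp θ) ≤ s * T := fun θ => (le_abs_self _).trans (hrT z hzZ θ)
  have hTQ : T ≤ Q := by
    rw [hQ]
    have : 0 ≤ M * T ^ 3 / y₀ := by positivity
    linarith
  have hsTρ : s * T ≤ ρ := (mul_le_mul_of_nonneg_left hTQ hs.le).trans hsQ.le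
  refine ⟨z, hzA, hzK, fun x => ⟨u z x, v z x⟩,
    ⟨⟨hloop.toIsLoop, fun θ => (hloop.curvature θ).trans ?_⟩, hloop.injective⟩,
    fun θ => ⟨(hdist z hzZ θ).trans hsTρ, (hd1 θ).trans ((hrle θ).trans hsTρ), ?_⟩⟩
  · exact congrArg (fun t => s⁻¹ + ε * t) (hKK' _ (hmemZ θ))
  · refine (hd2 θ).trans ?_
    have h1 := hr' (Circle.exp θ)
    have h2 : |ε| * r z (Circle.exp θ) ^ 3 *
        ‖fderiv ℝ K' ⟨u z (Circle.exp θ), v z (Circle.exp θ)⟩‖ / v z (Circle.exp θ) ≤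
        1 * (s * T) ^ 3 * M / y₀ := by
      gcongr
      · exact hrle θ
      · exact hM _
      · exact hvy z hzZ θ
    have h3 : 1 * (s * T) ^ 3 * M / y₀ ≤ s * (M * T ^ 3 / y₀) := by
      have e : 1 * (s * T) ^ 3 * M / y₀ = s ^ 3 * (M * T ^ 3 / y₀) := by ring
      rw [e]
      gcongr
      exact pow_le_of_le_one hs.le hs1.le (by norm_num)
    have h4 : s * Q = s * T + s * (M * T ^ 3 / y₀) := by rw [hQ]; ring
    linarith [hrle θ]

end Existence

theorem theoremT (K : ℂ → ℝ) (hK : ContDiffOn ℝ 1 K HypPlane)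
    (A : Set ℂ) (hA : IsOpen A) (hAc : IsCompact (closure A)) (hAH : closure A ⊆ HypPlane)
    (hstable : HasStableCriticalPoint K A) :
    (∃ k₀ : ℝ, 1 < k₀ ∧ ∀ k : ℝ, k₀ < k → ∃ ε₀ : ℝ, 0 < ε₀ ∧ ∀ ε : ℝ, |ε| < ε₀ →
      ∃ u : Circle → ℂ, IsEmbeddedKLoop (fun z => k + ε * K z) u) ∧
    (∀ k ε : ℕ → ℝ, Tendsto k atTop atTop → Tendsto ε atTop (𝓝 0) →
      ∃ φ : ℕ → ℕ, StrictMono φ ∧ ∃ z ∈ closure A, fderiv ℝ K z = 0 ∧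
        ∃ u : ℕ → Circle → ℂ,
          (∀ j, IsEmbeddedKLoop (fun p => k (φ j) + ε (φ j) * K p) (u j)) ∧
          TendstoC2 u (fun _ => z)) := by
  constructor
  · obtain ⟨s₀, hs₀, h⟩ := exists_loop_near_critical_point hK hAc hAH hstable one_pos
    -- The threshold `s₀` is uniform in `|ε| ≤ 1`, so `ε₀ = 1` serves every `k`.
    refine ⟨max 2 s₀⁻¹, lt_max_of_lt_left (by norm_num), fun k hk => ⟨1, one_pos, fun ε hε => ?_⟩⟩
    have hk2 : 2 < k := (le_max_left _ _).trans_lt hk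
    have hks : s₀⁻¹ < k := (le_max_right _ _).trans_lt hk
    obtain ⟨z, -, -, u, hu, -⟩ := h k⁻¹ ε (inv_pos.2 (by linarith))
      (inv_lt_of_inv_lt₀ hs₀ hks) hε.le
    rw [inv_inv] at hu
    exact ⟨u, hu⟩
  · intro k ε hk hε
    have hP : ∀ n : ℕ, ∀ᶠ h in atTop, ∃ z ∈ A, ‖fderiv ℝ K z‖ ≤ 1 / ((n : ℝ) + 1) ∧
        ∃ u : Circle → ℂ, IsEmbeddedKLoop (fun p => k h + ε h * K p) u ∧
          ∀ θ, ‖angular u θ - z‖ ≤ 1 / ((n : ℝ) + 1) ∧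
            ‖deriv (angular u) θ‖ ≤ 1 / ((n : ℝ) + 1) ∧
            ‖deriv (deriv (angular u)) θ‖ ≤ 1 / ((n : ℝ) + 1) := by
      intro n
      obtain ⟨s₀, hs₀, h⟩ := exists_loop_near_critical_point hK hAc hAH hstable
        (Nat.one_div_pos_of_nat (α := ℝ) (n := n))
      have hε1 : ∀ᶠ i in atTop, |ε i| < 1 := by
        have := hε.abs
        rw [abs_zero] at this
        exact this.eventually (gt_mem_nhds one_pos)
      filter_upwards [hk.eventually_gt_atTop 0, hk.eventually_gt_atTop s₀⁻¹, hε1] with i h0 hi hεi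
      have := h (k i)⁻¹ (ε i) (inv_pos.2 h0) (inv_lt_of_inv_lt₀ hs₀ hi) hεi.le
      rwa [inv_inv] at this
    -- A diagonal choice of indices with tolerance `1 / (n + 1)`; a second extraction then makes the
    -- centres converge.
    obtain ⟨φ, hφ, hex⟩ := extraction_forall_of_eventually hP
    choose z hzA hzK u hu hclose using hex
    obtain ⟨w, hw, ψ, hψ, hlim⟩ := hAc.tendsto_subseq fun n => subset_closure (hzA n)
    have hto : Tendsto (fun j => 1 / ((ψ j : ℝ) + 1)) atTop (𝓝 0) :=
      (tendsto_one_div_add_atTop_nhds_zero_nat (𝕜 := ℝ)).comp hψ.tendsto_atTop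
    refine ⟨φ ∘ ψ, hφ.comp hψ, w, hw, ?_, fun j => u (ψ j), fun j => hu (ψ j), ?_⟩
    · have hc : ContinuousAt (fderiv ℝ K) w :=
        (hK.continuousOn_fderiv_of_isOpen isOpen_hypPlane le_rfl).continuousAt
          (isOpen_hypPlane.mem_nhds (hAH hw))
      have h1 : Tendsto (fun j => fderiv ℝ K (z (ψ j))) atTop (𝓝 (fderiv ℝ K w)) :=
        hc.tendsto.comp hlim
      have h2 : Tendsto (fun j => fderiv ℝ K (z (ψ j))) atTop (𝓝 0) :=
        squeeze_zero_norm (fun j => hzK (ψ j)) hto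
      exact tendsto_nhds_unique h1 h2
    · have hang : angular (fun _ => w) = fun _ => w := rfl
      intro m hm
      rw [Metric.tendstoUniformly_iff, hang]
      intro δ hδ
      have hz : ∀ᶠ j in atTop, dist (z (ψ j)) w < δ / 2 :=
        (Metric.tendsto_nhds.1 hlim) _ (half_pos hδ)
      filter_upwards [hz, hto.eventually (gt_mem_nhds (half_pos hδ))] with j hj hj' θ
      obtain ⟨h0, h1, h2⟩ := hclose (ψ j) θ
      rw [dist_comm, dist_eq_norm]
      interval_cases m
      · rw [iteratedDeriv_zero, iteratedDeriv_zero, ← dist_eq_norm]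
        refine (dist_triangle _ (z (ψ j)) _).trans_lt ?_
        rw [dist_eq_norm]
        linarith
      · simp only [iteratedDeriv_one, deriv_const, sub_zero]
        linarith
      · have e : ∀ f : ℝ → ℂ, iteratedDeriv 2 f = deriv (deriv f) := fun f => by
          rw [iteratedDeriv_succ, iteratedDeriv_one]
        rw [e, e]
        simp only [deriv_const', deriv_const, sub_zero]
        linarith
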